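/- **Setting.** Let $k$ be a field, $\hat{\mathsf G}$ a finite group with a surjective homomorphism $\pi:\hat{\mathsf G}\to\{\pm1\}$, $\mathsf G=\ker\pi$, and let $\hat\alpha\in Z^3(B\hat{\mathsf G},k^\times_\pi)$ be a normalized twisted cocycle, i.e. $\hat\alpha([\omega_3|\omega_2|\omega_1])=1$ if some $\omega_i=1$ and $$\hat\alpha([\omega_4\omega_3|\omega_2|\omega_1])\,\hat\alpha([\omega_4|\omega_3|\omega_2\omega_1])=\hat\alpha([\omega_3|\omega_2|\omega_1])^{\pi(\omega_4)}\,\hat\alpha([\omega_4|\omega_3\omega_2|\omega_1])\,\hat\alpha([\omega_4|\omega_3|\omega_2]).$$ For a category $V$ put ${}^{+}V=V$ and ${}^{-}V=V^{\mathrm{op}}$. An *$\hat\alpha$-twisted Real $2$-representation* on a $k$-linear category $V$ consists of $k$-linear functors $\rho(\omega):{}^{\pi(\omega)}V\to V$ $(\omega\in\hat{\mathsf G})$ and natural isomorphisms $\psi_{\omega_2,\omega_1}:\rho(\omega_2)\circ{}^{\pi(\omega_2)}\rho(\omega_1)\Rightarrow\rho(\omega_2\omega_1)$ and $\psi_e:\rho(1)\Rightarrow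 1_V$ with $$\hat\alpha([\omega_3|\omega_2|\omega_1])\,\psi_{\omega_3\omega_2,\omega_1}\circ(\psi_{\omega_3,\omega_2}\rho(\omega_1))=\psi_{\omega_3,\omega_2\omega_1}\circ\rho(\omega_3)(\psi_{\omega_2,\omega_1}^{\pi(\omega_3)}),\quad \psi_{1,\omega}=\psi_e\,\rho(\omega),\quad \psi_{\omega,1}=\rho(\omega)(\psi_e^{\pi(\omega)}).$$ For a group $\mathsf H$ with trivial grading and $\alpha\in Z^3(B\mathsf H,k^\times)$ this is a linear representation of the categorical group $\mathcal H=\mathcal G(\mathsf H,\alpha)$. **Characters.** For $g\in\mathsf G$ let $\mathbb{T}\mathrm{r}_\rho(g)=\mathrm{Nat}(1_V,\rho(g))$. For $\omega\in\hat{\mathsf G}$ and $g'=\omega g^{\pi(\omega)}\omega^{-1}$, the linear map $\beta_{g,\omega}:\mathbb{T}\mathrm{r}_\rho(g)\to\mathbb{T}\mathrm{r}_\rho(g')$ sends $\phi$ to the transformation with component at $x$ $$x\to\rho(\omega)\rho(\omega^{-1})x\to\rho(\omega)\rho(g^{\pi(\omega)})\rho(\omega^{-1})x\to\rho(\omega g^{\pi(\omega)})\rho(\omega^{-1})x\to\rho(g')\rho(\omega)\rho(\omega^{-1})x\to\rho(g')x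 .$$ The first and last maps are given by $\psi_{\omega,\omega^{-1}}$ and $\psi_e$, the third by $\psi_{\omega,g^{\pi(\omega)}}$, the fourth by $\psi_{g',\omega}^{-1}$. The second map is $\rho(\omega)(\phi)$ if $\pi(\omega)=1$; if $\pi(\omega)=-1$ it is the value of the contravariant functor $\rho(\omega)$ on the composite $\rho(g^{-1})\xrightarrow{\rho(g^{-1})\phi}\rho(g^{-1})\rho(g)\xrightarrow{\psi_{g^{-1},g}}\rho(1)\xrightarrow{\psi_e}1_V$. If $g\in\mathsf G$, $\omega\in\hat{\mathsf G}$ satisfy $\omega g^{\pi(\omega)}=g\omega$ (a graded commuting pair) and $\mathbb{T}\mathrm{r}_\rho(g)$ is finite dimensional, the Real $2$-character is $\chi_\rho(g,\omega)=\mathrm{tr}(\beta_{g,\omega}\mid\mathbb{T}\mathrm{r}_\rho(g))$. **Induction.** Let $\mathsf H\le\mathsf G$ and let $\rho$ be a linear representation of $\mathcal H=\mathcal G(\mathsf H,\hat\alpha|_{\mathsf H})$ on a $k$-linear category $V$. Choose representatives $r_i$ of $\mathsf G/\mathsf H$. The representation $\mathrm{Ind}_{\mathcal H}^{\mathcal G}(\rho)$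 acts on $\prod_{\mathsf G/\mathsf H}V$ by $(g\cdot x)_j=\rho(h)(x_i)$ for $gr_i=r_jh$, $h\in\mathsf H$; if $g_1r_i=r_jh_1$ and $g_2r_j=r_lh_2$, the $l$-th component of $\mathrm{Ind}(\psi)_{g_2,g_1}$ is $$\frac{\hat\alpha([g_2|r_j|h_1])}{\hat\alpha([g_2|g_1|r_i])\,\hat\alpha([r_l|h_2|h_1])}\,\psi_{h_2,h_1},$$ and $\mathrm{Ind}(\psi)_e$ is $\psi_e$ in each component. Choose $\varsigma\in\hat{\mathsf G}\setminus\mathsf G$. For a linear representation $\rho$ of $\mathcal G=\mathcal G(\mathsf G,\hat\alpha|_{\mathsf G})$ on $W$, the Real $2$-representation $\mathrm{HInd}_{\mathcal G}^{\hat{\mathcal G}}(\rho)$ acts on $W\times W^{\mathrm{op}}$ by $g\cdot(x,y)=(\rho(g)x,\rho(\varsigma^{-1}g\varsigma)y)$ for $g\in\mathsf G$ and $\omega\cdot(x,y)=(\rho(\omega\varsigma)y,\rho(\varsigma^{-1}\omega)x)$ for $\omega\in\hat{\mathsf G}\setminus\mathsf G$. Writing $g'=\varsigma^{-1}g\varsigma$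 and $\psi^{-\mathrm{op}}$ for the inverse of $\psi$ viewed in $W^{\mathrm{op}}$, its coherence isomorphisms (first component; second component) are, for $g_i\in\mathsf G$ and $\omega_i\in\hat{\mathsf G}\setminus\mathsf G$, - $(g_2,g_1)$: $\ \psi_{g_2,g_1}$; $\ \dfrac{\hat\alpha([g_2|\varsigma|g_1'])}{\hat\alpha([g_2|g_1|\varsigma])\hat\alpha([\varsigma|g_2'|g_1'])}\,\psi^{-\mathrm{op}}_{g_2',g_1'}$ - $(\omega_2,g_1)$: $\ \dfrac{\hat\alpha([\omega_2|\varsigma|g_1'])}{\hat\alpha([\omega_2|g_1|\varsigma])}\,\psi_{\omega_2\varsigma,g_1'}$; $\ \hat\alpha([\varsigma|\varsigma^{-1}\omega_2|g_1])^{-1}\,\psi^{-\mathrm{op}}_{\varsigma^{-1}\omega_2,g_1}$ - $(g_2,\omega_1)$: $\ \hat\alpha([g_2|\omega_1|\varsigma])^{-1}\,\psi_{g_2,\omega_1\varsigma}$; $\ \dfrac{\hat\alpha([g_2|\varsigma|\varsigma^{-1}\omega_1])}{\hat\alpha([\varsigma|g_2'|\varsigma^{-1}\omega_1])}\,\psi^{-\mathrm{op}}_{g_2',\varsigma^{-1}\omega_1}$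 - $(\omega_2,\omega_1)$: $\ \hat\alpha([\omega_2|\varsigma|\varsigma^{-1}\omega_1])\,\psi_{\omega_2\varsigma,\varsigma^{-1}\omega_1}$; $\ \dfrac{1}{\hat\alpha([\omega_2|\omega_1|\varsigma])\hat\alpha([\varsigma|\varsigma^{-1}\omega_2|\omega_1\varsigma])}\,\psi^{-\mathrm{op}}_{\varsigma^{-1}\omega_2,\omega_1\varsigma}$ together with $(\psi_e;\psi_e^{-\mathrm{op}})$. Set $\mathrm{HInd}_{\mathcal H}^{\hat{\mathcal G}}=\mathrm{HInd}_{\mathcal G}^{\hat{\mathcal G}}\circ\mathrm{Ind}_{\mathcal H}^{\mathcal G}$. **Transgression.** For $g\in\mathsf G$, $\omega_1,\omega_2\in\hat{\mathsf G}$ put $$\tau_\pi^{\mathrm{ref}}(\hat\alpha)([\omega_2|\omega_1]g)=\hat\alpha([g|g^{-1}|g])^{\delta}\left(\frac{\hat\alpha([\omega_1g^{-\pi(\omega_1)}\omega_1^{-1}|\omega_1g^{\pi(\omega_1)}\omega_1^{-1}|\omega_1])\,\hat\alpha([\omega_1|g^{-\pi(\omega_1)}|g^{\pi(\omega_1)}])}{\hat\alpha([\omega_1g^{-\pi(\omega_1)}\omega_1^{-1}|\omega_1|g^{\pi(\omega_1)}])}\right)^{\frac{\pi(\omega_2)-1}2}\frac{\hat\alpha([\omega_2|\omega_1|g^{\pi(\omega_2\omega_1)}])\,\hat\alpha([\omega_2\omega_1g^{\pi(\omega_2\omega_1)}(\omega_2\omega_1)^{-1}|\omega_2|\omega_1])}{\hat\alpha([\omega_2|\omega_1g^{\pi(\omega_2\omega_1)}\omega_1^{-1}|\omega_1])},$$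 with $\delta=1$ if $\pi(\omega_1)=\pi(\omega_2)=-1$ and $\delta=0$ otherwise, and for a graded commuting pair $(g,\omega)$ and $\sigma\in\hat{\mathsf G}$ put $$\tau\tau_\pi^{\mathrm{ref}}(\hat\alpha)([\sigma]g\xrightarrow{\omega}g)=\frac{\tau_\pi^{\mathrm{ref}}(\hat\alpha)([\sigma\omega\sigma^{-1}|\sigma]g)}{\tau_\pi^{\mathrm{ref}}(\hat\alpha)([\sigma|\omega]g)}.$$ **Theorem.** Let $\mathsf H\le\mathsf G$ and let $\rho$ be a linear representation of $\mathcal H$ on a $k$-linear category $V$ such that $\mathbb{T}\mathrm{r}_\rho(h)$ is finite dimensional for every $h\in\mathsf H$. Then, for every choice of $\varsigma$ and of coset representatives: 1. the spaces $\mathbb{T}\mathrm{r}_{\mathrm{HInd}_{\mathcal H}^{\hat{\mathcal G}}(\rho)}(g)$, $g\in\mathsf G$, are finite dimensional, so that the Real $2$-character of $\mathrm{HInd}_{\mathcal H}^{\hat{\mathcal G}}(\rho)$ is defined; 2. if $|\mathsf H|$ is invertible in $k$, then for every graded commuting pair $(g,\omega)$ $$\chi_{\mathrm{HInd}_{\mathcal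 H}^{\hat{\mathcal G}}(\rho)}(g,\omega)=\frac1{|\mathsf H|}\sum_{\substack{\sigma\in\hat{\mathsf G}\\ \sigma g^{\pi(\sigma)}\sigma^{-1},\ \sigma\omega\sigma^{-1}\in\mathsf H}}\tau\tau_\pi^{\mathrm{ref}}(\hat\alpha)([\sigma]g\xrightarrow{\omega}g)^{-1}\cdot\chi_\rho(\sigma g^{\pi(\sigma)}\sigma^{-1},\sigma\omega\sigma^{-1});$$ 3. (over any $k$) the character is supported on $\pi_0(\Lambda^2B\mathsf G)\subset\pi_0(\Lambda\Lambda_\pi^{\mathrm{ref}}B\hat{\mathsf G})$: if $(g,\omega)$ is a graded commuting pair with $\chi_{\mathrm{HInd}_{\mathcal H}^{\hat{\mathcal G}}(\rho)}(g,\omega)\ne0$, then $\omega\in\mathsf G$. -/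

import Mathlib

open CategoryTheory Opposite

universe w v u

namespace RealTwoRep

/-! ### Products and opposites of `k`-linear categories -/

section LinearCategories

variable {k : Type*} [Field k] {C : Type*} [Category C] [Preadditive C] [Linear k C]
  {D : Type*} [Category D] [Preadditive D] [Linear k D] {ι : Type*}

instance linearOpposite : Linear k Cᵒᵖ where
  homModule X Y :=
    { smul := fun a f => (a • f.unop).op
      one_smul := fun f => Quiver.Hom.unop_inj (one_smul k f.unop)
      mul_smul := fun a b f => Quiver.Hom.unop_inj (mul_smul a b f.unop)
      smul_zero := fun a => Quiver.Hom.unop_inj (smul_zero (A := Y.unop ⟶ X.unop) a)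
      smul_add := fun a f g => Quiver.Hom.unop_inj (smul_add a f.unop g.unop)
      add_smul := fun a b f => Quiver.Hom.unop_inj (add_smul a b f.unop)
      zero_smul := fun f => Quiver.Hom.unop_inj (zero_smul k f.unop) }
  smul_comp _ _ _ a f g := Quiver.Hom.unop_inj (Linear.comp_smul _ _ _ g.unop a f.unop)
  comp_smul _ _ _ f a g := Quiver.Hom.unop_inj (Linear.smul_comp _ _ _ a g.unop f.unop)

instance preadditivePi : Preadditive (ι → C) where
  homGroup X Y := inferInstanceAs (AddCommGroup (∀ i, X i ⟶ Y i))
  add_comp _ _ _ _ _ _ := funext fun _ => Preadditive.add_comp _ _ _ _ _ _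
  comp_add _ _ _ _ _ _ := funext fun _ => Preadditive.comp_add _ _ _ _ _ _

instance linearPi : Linear k (ι → C) where
  homModule X Y := inferInstanceAs (Module k (∀ i, X i ⟶ Y i))
  smul_comp _ _ _ _ _ _ := funext fun _ => Linear.smul_comp _ _ _ _ _ _
  comp_smul _ _ _ _ _ _ := funext fun _ => Linear.comp_smul _ _ _ _ _ _

instance preadditiveProd : Preadditive (C × D) where
  homGroup X Y := inferInstanceAs (AddCommGroup ((X.1 ⟶ Y.1) × (X.2 ⟶ Y.2)))
  add_comp _ _ _ _ _ _ := Prod.ext (Preadditive.add_comp _ _ _ _ _ _)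
    (Preadditive.add_comp _ _ _ _ _ _)
  comp_add _ _ _ _ _ _ := Prod.ext (Preadditive.comp_add _ _ _ _ _ _)
    (Preadditive.comp_add _ _ _ _ _ _)

instance linearProd : Linear k (C × D) where
  homModule X Y := inferInstanceAs (Module k ((X.1 ⟶ Y.1) × (X.2 ⟶ Y.2)))
  smul_comp _ _ _ _ _ _ := Prod.ext (Linear.smul_comp _ _ _ _ _ _)
    (Linear.smul_comp _ _ _ _ _ _)
  comp_smul _ _ _ _ _ _ := Prod.ext (Linear.comp_smul _ _ _ _ _ _)
    (Linear.comp_smul _ _ _ _ _ _)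

@[simp] lemma unop_smul' {X Y : Cᵒᵖ} (a : k) (f : X ⟶ Y) : (a • f).unop = a • f.unop := rfl
@[simp] lemma op_smul' {X Y : C} (a : k) (f : X ⟶ Y) : (a • f).op = a • f.op := rfl
@[simp] lemma pi_add_apply {X Y : ι → C} (f g : X ⟶ Y) (i : ι) : (f + g) i = f i + g i := rfl
@[simp] lemma pi_smul_apply {X Y : ι → C} (a : k) (f : X ⟶ Y) (i : ι) :
    (a • f) i = a • f i := rfl
@[simp] lemma prod_add_fst {X Y : C × D} (f g : X ⟶ Y) : (f + g).1 = f.1 + g.1 := rfl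
@[simp] lemma prod_add_snd {X Y : C × D} (f g : X ⟶ Y) : (f + g).2 = f.2 + g.2 := rfl
@[simp] lemma prod_smul_fst {X Y : C × D} (a : k) (f : X ⟶ Y) : (a • f).1 = a • f.1 := rfl
@[simp] lemma prod_smul_snd {X Y : C × D} (a : k) (f : X ⟶ Y) : (a • f).2 = a • f.2 := rfl

/-- An isomorphism rescaled by a unit of the ground field. -/
@[simps] def scaleIso {X Y : C} (c : kˣ) (e : X ≅ Y) : X ≅ Y where
  hom := (c : k) • e.hom
  inv := ((c⁻¹ : kˣ) : k) • e.inv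
  hom_inv_id := by simp [smul_smul]
  inv_hom_id := by simp [smul_smul]

end LinearCategories

/-! ### Twisted 3-cocycles -/

/-- The group of normalized cocycles `Z³(BΓ, kˣ_π)`, where `ω ∈ Γ` acts on `kˣ` by
`a ↦ a ^ π(ω)`. The value `α ω₃ ω₂ ω₁` is `α([ω₃|ω₂|ω₁])`. For `π = 1` these are the ordinary
normalized 3-cocycles of `Γ`. -/
structure TwistedCocycle {Γ : Type*} [Group Γ] (k : Type*) [Field k] (π : Γ →* ℤˣ) where
  toFun : Γ → Γ → Γ → kˣ
  cocycle : ∀ ω₄ ω₃ ω₂ ω₁,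
    toFun (ω₄ * ω₃) ω₂ ω₁ * toFun ω₄ ω₃ (ω₂ * ω₁) =
      toFun ω₃ ω₂ ω₁ ^ ((π ω₄ : ℤˣ) : ℤ) * toFun ω₄ (ω₃ * ω₂) ω₁ * toFun ω₄ ω₃ ω₂
  one_left : ∀ b c, toFun 1 b c = 1
  one_mid : ∀ a c, toFun a 1 c = 1
  one_right : ∀ a b, toFun a b 1 = 1

attribute [simp] TwistedCocycle.one_left TwistedCocycle.one_mid TwistedCocycle.one_right

section Cocycles

variable {k : Type*} [Field k] {Γ : Type*} [Group Γ] {π : Γ →* ℤˣ}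

instance : CoeFun (TwistedCocycle k π) fun _ => Γ → Γ → Γ → kˣ := ⟨TwistedCocycle.toFun⟩

/-- The restriction of a twisted cocycle to a subgroup of the ungraded group `ker π`. -/
@[simps] def TwistedCocycle.res (α : TwistedCocycle k π) {H : Subgroup Γ} (hH : H ≤ π.ker) :
    TwistedCocycle k (1 : H →* ℤˣ) where
  toFun a b c := α a b c
  cocycle a b c d := by
    have h := α.cocycle a b c d
    rw [show π a = 1 from hH a.2] at h
    simpa using h
  one_left _ _ := α.one_left _ _
  one_mid _ _ := α.one_mid _ _
  one_right _ _ := α.one_right _ _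

/-- The scalar `α([ω₂|s₁|η₁]) / (α([ω₂|ω₁|s₀]) α([s₂|η₂|η₁]))` attached to
`ω₁ s₀ = s₁ η₁` and `ω₂ s₁ = s₂ η₂`. -/
def TwistedCocycle.coeff (α : TwistedCocycle k π) (ω₂ ω₁ s₂ s₁ s₀ η₂ η₁ : Γ) : kˣ :=
  α ω₂ s₁ η₁ / (α ω₂ ω₁ s₀ * α s₂ η₂ η₁)

lemma TwistedCocycle.coeff_assoc (α : TwistedCocycle k π)
    {ω₃ ω₂ ω₁ s₃ s₂ s₁ s₀ η₃ η₂ η₁ : Γ}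
    (e₁ : ω₁ * s₀ = s₁ * η₁) (e₂ : ω₂ * s₁ = s₂ * η₂) (e₃ : ω₃ * s₂ = s₃ * η₃) :
    α ω₃ ω₂ ω₁ * α.coeff ω₃ ω₂ s₃ s₂ s₁ η₃ η₂ * α.coeff (ω₃ * ω₂) ω₁ s₃ s₁ s₀ (η₃ * η₂) η₁ =
      α η₃ η₂ η₁ ^ ((π s₃ : ℤˣ) : ℤ) * α.coeff ω₂ ω₁ s₂ s₁ s₀ η₂ η₁ ^ ((π ω₃ : ℤˣ) : ℤ) *
        α.coeff ω₃ (ω₂ * ω₁) s₃ s₂ s₀ η₃ (η₂ * η₁) := by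
  have h₁ := congrArg Additive.ofMul (α.cocycle ω₃ ω₂ ω₁ s₀)
  have h₂ := congrArg Additive.ofMul (α.cocycle ω₃ ω₂ s₁ η₁)
  have h₃ := congrArg Additive.ofMul (α.cocycle ω₃ s₂ η₂ η₁)
  have h₄ := congrArg Additive.ofMul (α.cocycle s₃ η₃ η₂ η₁)
  rw [e₁] at h₁
  rw [e₂] at h₂
  rw [e₃] at h₃
  apply Additive.ofMul.injective
  simp only [coeff, ofMul_mul, ofMul_div, ofMul_zpow] at *
  linear_combination (norm := module) h₂ - h₁ - h₃ + h₄

end Cocycles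
/-! ### Twisted Real 2-representations on a linear category -/

/-- The degrees `+1` and `-1`. -/
inductive Parity
  | even
  | odd

/-- The degree as an element of `ℤ₂ = {±1}`. -/
def Parity.sign : Parity → ℤˣ
  | .even => 1
  | .odd => -1

lemma sign_one {Γ : Type*} [Group Γ] (π : Γ →* ℤˣ) : π 1 = Parity.even.sign := map_one π

lemma sign_inv {Γ : Type*} [Group Γ] {π : Γ →* ℤˣ} {ω : Γ} {ε : Parity} (h : π ω = ε.sign) :
    π ω⁻¹ = ε.sign := by
  rw [map_inv, h, Int.units_inv_eq_self]

/-- Functors `{}^εV ⥤ V`: a covariant endofunctor of `V` for `ε = 1`, a functor `Vᵒᵖ ⥤ V` for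
`ε = -1`. -/
def SignedEnd (V : Type u) [Category.{v} V] : Parity → Type (max u v)
  | .even => V ⥤ V
  | .odd => Vᵒᵖ ⥤ V

namespace SignedEnd

variable {V : Type u} [Category.{v} V]

/-- A signed endofunctor of degree `1` as a functor. -/
def cov (F : SignedEnd V .even) : V ⥤ V := F

/-- A signed endofunctor of degree `-1` as a functor. -/
def contra (F : SignedEnd V .odd) : Vᵒᵖ ⥤ V := F

/-- The action on objects. -/
def obj : {ε : Parity} → SignedEnd V ε → V → V
  | .even, F, x => F.cov.obj x
  | .odd, F, x => F.contra.obj (op x)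

/-- The value of a signed endofunctor `F` of degree `ε` on `e ^ ε`, for an isomorphism `e`. -/
def mapIso : {ε : Parity} → (F : SignedEnd V ε) → {x y : V} → (x ≅ y) → (F.obj x ≅ F.obj y)
  | .even, F, _, _, e => F.cov.mapIso e
  | .odd, F, _, _, e => F.contra.mapIso e.symm.op

/-- `k`-linearity of a signed endofunctor. -/
def IsLinear (k : Type*) [Field k] [Preadditive V] [Linear k V] :
    {ε : Parity} → SignedEnd V ε → Prop
  | .even, F => F.cov.Additive ∧ F.cov.Linear k
  | .odd, F => F.contra.Additive ∧ F.contra.Linear k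

end SignedEnd

/-- An `α`-twisted Real 2-representation on a `k`-linear category `V`, for the group `Γ` with
grading `π` and `α ∈ Z³(BΓ, kˣ_π)`; equivalently, a linear Real representation on `V` of the
categorical group `𝒢(ker π, α)` with Real structure `𝒢(Γ, α)`.

* `act` is the family of `k`-linear functors `ρ(ω) : {}^{π(ω)}V ⥤ V`. They are automatically
  equivalences, by the other data.
* `ψ` is the family of natural isomorphisms
  `ψ_{ω₂,ω₁} : ρ(ω₂) ∘ {}^{π(ω₂)}ρ(ω₁) ⟹ ρ(ω₂ω₁)`, given by their components at the objects of
  `V`. To avoid transport along equations, the target is indexed by an element `ω` with a proof of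
  `ω₂ω₁ = ω`, and degrees are indexed by a parity `ε` with a proof of `π(ω) = ε`.
* `ψe` is the natural isomorphism `ρ(1) ⟹ 1_V`.

For `π = 1` this is a linear representation of the categorical group `𝒢(Γ, α)`. -/
structure TwistedRep {k : Type*} [Field k] {Γ : Type*} [Group Γ] (π : Γ →* ℤˣ)
    (α : TwistedCocycle k π) (V : Type u) [Category.{v} V] [Preadditive V] [Linear k V] where
  act : ∀ {ε : Parity} {ω : Γ}, π ω = ε.sign → SignedEnd V ε
  linear : ∀ {ε : Parity} {ω : Γ} (h : π ω = ε.sign), (act h).IsLinear k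
  ψ : ∀ {ε₂ ε₁ ε : Parity} {ω₂ ω₁ ω : Γ} (h₂ : π ω₂ = ε₂.sign) (h₁ : π ω₁ = ε₁.sign)
    (h : π ω = ε.sign), ω₂ * ω₁ = ω → ∀ x : V, (act h₂).obj ((act h₁).obj x) ≅ (act h).obj x
  ψe : (act (sign_one π)).cov ≅ 𝟭 V
  /-- naturality of `ψ_{ω₂,ω₁}` for `π(ω₂) = 1`, `π(ω₁) = 1` -/
  nat_even_even : ∀ {ω₂ ω₁ ω : Γ} (h₂ : π ω₂ = Parity.even.sign) (h₁ : π ω₁ = Parity.even.sign)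
    (h : π ω = Parity.even.sign) (m : ω₂ * ω₁ = ω) {x y : V} (f : x ⟶ y),
    (act h₂).cov.map ((act h₁).cov.map f) ≫ (ψ h₂ h₁ h m y).hom =
      (ψ h₂ h₁ h m x).hom ≫ (act h).cov.map f
  /-- naturality of `ψ_{ω₂,ω₁}` for `π(ω₂) = 1`, `π(ω₁) = -1` -/
  nat_even_odd : ∀ {ω₂ ω₁ ω : Γ} (h₂ : π ω₂ = Parity.even.sign) (h₁ : π ω₁ = Parity.odd.sign)
    (h : π ω = Parity.odd.sign) (m : ω₂ * ω₁ = ω) {x y : V} (f : x ⟶ y),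
    (act h₂).cov.map ((act h₁).contra.map f.op) ≫ (ψ h₂ h₁ h m x).hom =
      (ψ h₂ h₁ h m y).hom ≫ (act h).contra.map f.op
  /-- naturality of `ψ_{ω₂,ω₁}` for `π(ω₂) = -1`, `π(ω₁) = 1` -/
  nat_odd_even : ∀ {ω₂ ω₁ ω : Γ} (h₂ : π ω₂ = Parity.odd.sign) (h₁ : π ω₁ = Parity.even.sign)
    (h : π ω = Parity.odd.sign) (m : ω₂ * ω₁ = ω) {x y : V} (f : x ⟶ y),
    (act h₂).contra.map ((act h₁).cov.map f).op ≫ (ψ h₂ h₁ h m x).hom =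
      (ψ h₂ h₁ h m y).hom ≫ (act h).contra.map f.op
  /-- naturality of `ψ_{ω₂,ω₁}` for `π(ω₂) = -1`, `π(ω₁) = -1` -/
  nat_odd_odd : ∀ {ω₂ ω₁ ω : Γ} (h₂ : π ω₂ = Parity.odd.sign) (h₁ : π ω₁ = Parity.odd.sign)
    (h : π ω = Parity.even.sign) (m : ω₂ * ω₁ = ω) {x y : V} (f : x ⟶ y),
    (act h₂).contra.map ((act h₁).contra.map f.op).op ≫ (ψ h₂ h₁ h m y).hom =
      (ψ h₂ h₁ h m x).hom ≫ (act h).cov.map f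
  /-- `α([ω₃|ω₂|ω₁]) ψ_{ω₃ω₂,ω₁} ∘ (ψ_{ω₃,ω₂} ρ(ω₁)) = ψ_{ω₃,ω₂ω₁} ∘ ρ(ω₃)(ψ_{ω₂,ω₁}^{π(ω₃)})` -/
  assoc : ∀ {ε₃ ε₂ ε₁ ε₃₂ ε₂₁ ε : Parity} {ω₃ ω₂ ω₁ ω₃₂ ω₂₁ ω : Γ}
    (h₃ : π ω₃ = ε₃.sign) (h₂ : π ω₂ = ε₂.sign) (h₁ : π ω₁ = ε₁.sign)
    (h₃₂ : π ω₃₂ = ε₃₂.sign) (h₂₁ : π ω₂₁ = ε₂₁.sign) (h : π ω = ε.sign)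
    (m₃₂ : ω₃ * ω₂ = ω₃₂) (m₂₁ : ω₂ * ω₁ = ω₂₁) (m : ω₃₂ * ω₁ = ω) (m' : ω₃ * ω₂₁ = ω) (x : V),
    (α ω₃ ω₂ ω₁ : k) •
        ((ψ h₃ h₂ h₃₂ m₃₂ ((act h₁).obj x)).hom ≫ (ψ h₃₂ h₁ h m x).hom) =
      ((act h₃).mapIso (ψ h₂ h₁ h₂₁ m₂₁ x)).hom ≫ (ψ h₃ h₂₁ h m' x).hom
  /-- `ψ_{1,ω} = ψe ρ(ω)` -/
  unit_left : ∀ {ε : Parity} {ω : Γ} (h : π ω = ε.sign) (x : V),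
    ψ (sign_one π) h h (one_mul ω) x = ψe.app ((act h).obj x)
  /-- `ψ_{ω,1} = ρ(ω)(ψe ^ π(ω))` -/
  unit_right : ∀ {ε : Parity} {ω : Γ} (h : π ω = ε.sign) (x : V),
    ψ h (sign_one π) h (mul_one ω) x = (act h).mapIso (ψe.app x)

namespace TwistedRep

section Ungraded

variable {k : Type*} [Field k] {Γ : Type*} [Group Γ] {α : TwistedCocycle k (1 : Γ →* ℤˣ)}
  {V : Type u} [Category.{v} V] [Preadditive V] [Linear k V]

/-- The functor `ρ(g)` of an ungraded representation. -/
def fn (ρ : TwistedRep 1 α V) (g : Γ) : V ⥤ V := (ρ.act (ε := .even) (ω := g) rfl).cov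

/-- The isomorphism `ψ_{g₂,g₁}` of an ungraded representation. -/
def mulIso (ρ : TwistedRep 1 α V) {g₂ g₁ g : Γ} (m : g₂ * g₁ = g) (x : V) :
    (ρ.fn g₂).obj ((ρ.fn g₁).obj x) ≅ (ρ.fn g).obj x :=
  ρ.ψ (ε₂ := .even) (ε₁ := .even) (ε := .even) rfl rfl rfl m x

/-- The isomorphism `ψe` of an ungraded representation. -/
def oneIso (ρ : TwistedRep 1 α V) : ρ.fn 1 ≅ 𝟭 V := ρ.ψe

instance (ρ : TwistedRep 1 α V) (g : Γ) : (ρ.fn g).Additive :=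
  (ρ.linear (ε := .even) (ω := g) rfl).1

instance (ρ : TwistedRep 1 α V) (g : Γ) : (ρ.fn g).Linear k :=
  (ρ.linear (ε := .even) (ω := g) rfl).2

lemma mulIso_nat (ρ : TwistedRep 1 α V) {g₂ g₁ g : Γ} (m : g₂ * g₁ = g) {x y : V} (f : x ⟶ y) :
    (ρ.fn g₂).map ((ρ.fn g₁).map f) ≫ (ρ.mulIso m y).hom =
      (ρ.mulIso m x).hom ≫ (ρ.fn g).map f :=
  ρ.nat_even_even rfl rfl rfl m f

lemma mulIso_inv_nat (ρ : TwistedRep 1 α V) {g₂ g₁ g : Γ} (m : g₂ * g₁ = g) {x y : V}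
    (f : x ⟶ y) :
    (ρ.mulIso m x).inv ≫ (ρ.fn g₂).map ((ρ.fn g₁).map f) =
      (ρ.fn g).map f ≫ (ρ.mulIso m y).inv := by
  rw [Iso.inv_comp_eq, ← Category.assoc, Iso.eq_comp_inv, mulIso_nat]

lemma mulIso_assoc (ρ : TwistedRep 1 α V) {g₃ g₂ g₁ g₃₂ g₂₁ g : Γ} (m₃₂ : g₃ * g₂ = g₃₂)
    (m₂₁ : g₂ * g₁ = g₂₁) (m : g₃₂ * g₁ = g) (m' : g₃ * g₂₁ = g) (x : V) :
    (α g₃ g₂ g₁ : k) • ((ρ.mulIso m₃₂ ((ρ.fn g₁).obj x)).hom ≫ (ρ.mulIso m x).hom) =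
      (ρ.fn g₃).map (ρ.mulIso m₂₁ x).hom ≫ (ρ.mulIso m' x).hom :=
  ρ.assoc (ε₃ := .even) (ε₂ := .even) (ε₁ := .even) (ε₃₂ := .even) (ε₂₁ := .even) (ε := .even)
    rfl rfl rfl rfl rfl rfl m₃₂ m₂₁ m m' x

lemma mulIso_assoc_scaled (ρ : TwistedRep 1 α V) {g₃ g₂ g₁ g₃₂ g₂₁ g : Γ} (m₃₂ : g₃ * g₂ = g₃₂)
    (m₂₁ : g₂ * g₁ = g₂₁) (m : g₃₂ * g₁ = g) (m' : g₃ * g₂₁ = g) (x : V) {a c₁ c₂ c₃ c₄ : kˣ}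
    (hc : a * c₁ * c₂ = α g₃ g₂ g₁ * c₃ * c₄) :
    (a : k) • ((scaleIso c₁ (ρ.mulIso m₃₂ ((ρ.fn g₁).obj x))).hom ≫
        (scaleIso c₂ (ρ.mulIso m x)).hom) =
      (ρ.fn g₃).map (scaleIso c₃ (ρ.mulIso m₂₁ x)).hom ≫ (scaleIso c₄ (ρ.mulIso m' x)).hom := by
  have hc' := congrArg (Units.val) hc
  push_cast at hc'
  simp only [scaleIso_hom, Functor.map_smul,
    Linear.smul_comp, Linear.comp_smul, ← mulIso_assoc ρ m₃₂ m₂₁ m m' x, smul_smul]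
  congr 1
  linear_combination hc'

lemma mulIso_assoc_scaled_inv (ρ : TwistedRep 1 α V) {g₃ g₂ g₁ g₃₂ g₂₁ g : Γ}
    (m₃₂ : g₃ * g₂ = g₃₂) (m₂₁ : g₂ * g₁ = g₂₁) (m : g₃₂ * g₁ = g) (m' : g₃ * g₂₁ = g) (x : V)
    {a c₁ c₂ c₃ c₄ : kˣ} (hc : a⁻¹ * c₁ * c₂ = α g₃ g₂ g₁ * c₃ * c₄) :
    (a : k) • ((scaleIso c₂ (ρ.mulIso m x)).inv ≫
        (scaleIso c₁ (ρ.mulIso m₃₂ ((ρ.fn g₁).obj x))).inv) =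
      (scaleIso c₄ (ρ.mulIso m' x)).inv ≫ (ρ.fn g₃).map (scaleIso c₃ (ρ.mulIso m₂₁ x)).inv := by
  have h : scaleIso a⁻¹ (scaleIso c₁ (ρ.mulIso m₃₂ ((ρ.fn g₁).obj x)) ≪≫
      scaleIso c₂ (ρ.mulIso m x)) =
      (ρ.fn g₃).mapIso (scaleIso c₃ (ρ.mulIso m₂₁ x)) ≪≫ scaleIso c₄ (ρ.mulIso m' x) :=
    Iso.ext (ρ.mulIso_assoc_scaled m₃₂ m₂₁ m m' x hc)
  simpa using congrArg Iso.inv h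

lemma oneIso_left (ρ : TwistedRep 1 α V) (g : Γ) (x : V) :
    ρ.mulIso (one_mul g) x = ρ.oneIso.app ((ρ.fn g).obj x) :=
  ρ.unit_left (ε := .even) (ω := g) rfl x

lemma oneIso_right (ρ : TwistedRep 1 α V) (g : Γ) (x : V) :
    ρ.mulIso (mul_one g) x = (ρ.fn g).mapIso (ρ.oneIso.app x) :=
  ρ.unit_right (ε := .even) (ω := g) rfl x

/-- The isomorphism `ψe` for an element `g` with a proof of `g = 1`. -/
def oneIsoOf (ρ : TwistedRep 1 α V) {g : Γ} (hg : g = 1) (x : V) : (ρ.fn g).obj x ≅ x :=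
  eqToIso (by rw [hg]) ≪≫ ρ.oneIso.app x

lemma oneIsoOf_nat (ρ : TwistedRep 1 α V) {g : Γ} (hg : g = 1) {x y : V} (f : x ⟶ y) :
    (ρ.fn g).map f ≫ (ρ.oneIsoOf hg y).hom = (ρ.oneIsoOf hg x).hom ≫ f := by
  subst hg
  simp [oneIsoOf]

lemma oneIsoOf_inv_nat (ρ : TwistedRep 1 α V) {g : Γ} (hg : g = 1) {x y : V} (f : x ⟶ y) :
    f ≫ (ρ.oneIsoOf hg y).inv = (ρ.oneIsoOf hg x).inv ≫ (ρ.fn g).map f := by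
  subst hg
  simpa [oneIsoOf] using ρ.oneIso.inv.naturality f

lemma mulIso_one_left (ρ : TwistedRep 1 α V) {g₂ g : Γ} (hg : g₂ = 1) (m : g₂ * g = g) {c : kˣ}
    (hc : c = 1) (x : V) :
    scaleIso c (ρ.mulIso m x) = ρ.oneIsoOf hg ((ρ.fn g).obj x) := by
  subst hg hc
  have := ρ.oneIso_left g x
  ext
  simp [oneIsoOf, this]

lemma mulIso_one_right (ρ : TwistedRep 1 α V) {g₁ g : Γ} (hg : g₁ = 1) (m : g * g₁ = g) {c : kˣ}
    (hc : c = 1) (x : V) :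
    scaleIso c (ρ.mulIso m x) = (ρ.fn g).mapIso (ρ.oneIsoOf hg x) := by
  subst hg hc
  have := ρ.oneIso_right g x
  ext
  simp [oneIsoOf, this]

lemma scale_mulIso_nat (ρ : TwistedRep 1 α V) {g₂ g₁ g : Γ} (m : g₂ * g₁ = g) (c : kˣ) {x y : V}
    (f : x ⟶ y) :
    (ρ.fn g₂).map ((ρ.fn g₁).map f) ≫ (scaleIso c (ρ.mulIso m y)).hom =
      (scaleIso c (ρ.mulIso m x)).hom ≫ (ρ.fn g).map f := by
  simp [mulIso_nat]

lemma scale_mulIso_inv_nat (ρ : TwistedRep 1 α V) {g₂ g₁ g : Γ} (m : g₂ * g₁ = g) (c : kˣ)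
    {x y : V} (f : x ⟶ y) :
    (scaleIso c (ρ.mulIso m x)).inv ≫ (ρ.fn g₂).map ((ρ.fn g₁).map f) =
      (ρ.fn g).map f ≫ (scaleIso c (ρ.mulIso m y)).inv := by
  simp [mulIso_inv_nat]

lemma not_odd {g : Γ} (h : (1 : Γ →* ℤˣ) g = Parity.odd.sign) : False :=
  absurd (show (1 : ℤˣ) = -1 from h) (by decide)

/-- A representation of an ungraded group is determined by its data in degree `1`. -/
def ofUngraded (F : Γ → V ⥤ V) (hF : ∀ g, (F g).Additive ∧ (F g).Linear k)
    (ψ : ∀ {g₂ g₁ g : Γ}, g₂ * g₁ = g → ∀ x : V, (F g₂).obj ((F g₁).obj x) ≅ (F g).obj x)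
    (ψe : F 1 ≅ 𝟭 V)
    (nat : ∀ {g₂ g₁ g : Γ} (m : g₂ * g₁ = g) {x y : V} (f : x ⟶ y),
      (F g₂).map ((F g₁).map f) ≫ (ψ m y).hom = (ψ m x).hom ≫ (F g).map f)
    (assoc : ∀ {g₃ g₂ g₁ g₃₂ g₂₁ g : Γ} (m₃₂ : g₃ * g₂ = g₃₂) (m₂₁ : g₂ * g₁ = g₂₁)
      (m : g₃₂ * g₁ = g) (m' : g₃ * g₂₁ = g) (x : V),
      (α g₃ g₂ g₁ : k) • ((ψ m₃₂ ((F g₁).obj x)).hom ≫ (ψ m x).hom) =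
        (F g₃).map (ψ m₂₁ x).hom ≫ (ψ m' x).hom)
    (unit_left : ∀ (g : Γ) (x : V), ψ (one_mul g) x = ψe.app ((F g).obj x))
    (unit_right : ∀ (g : Γ) (x : V), ψ (mul_one g) x = (F g).mapIso (ψe.app x)) :
    TwistedRep 1 α V where
  act {ε ω} h :=
    match ε, h with
    | .even, _ => F ω
    | .odd, h => (not_odd h).elim
  linear {ε ω} h :=
    match ε, h with
    | .even, _ => hF ω
    | .odd, h => (not_odd h).elim
  ψ {ε₂ ε₁ ε _ _ _} h₂ h₁ h m x :=
    match ε₂, ε₁, ε, h₂, h₁, h with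
    | .even, .even, .even, _, _, _ => ψ m x
    | .odd, _, _, h, _, _ => (not_odd h).elim
    | _, .odd, _, _, h, _ => (not_odd h).elim
    | _, _, .odd, _, _, h => (not_odd h).elim
  ψe := ψe
  nat_even_even _ _ _ m _ _ f := nat m f
  nat_even_odd _ h := (not_odd h).elim
  nat_odd_even h := (not_odd h).elim
  nat_odd_odd h := (not_odd h).elim
  assoc {ε₃ ε₂ ε₁ ε₃₂ ε₂₁ ε _ _ _ _ _ _} h₃ h₂ h₁ h₃₂ h₂₁ h m₃₂ m₂₁ m m' x := by
    cases ε₃ <;> [skip; exact (not_odd h₃).elim]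
    cases ε₂ <;> [skip; exact (not_odd h₂).elim]
    cases ε₁ <;> [skip; exact (not_odd h₁).elim]
    cases ε₃₂ <;> [skip; exact (not_odd h₃₂).elim]
    cases ε₂₁ <;> [skip; exact (not_odd h₂₁).elim]
    cases ε <;> [skip; exact (not_odd h).elim]
    exact assoc m₃₂ m₂₁ m m' x
  unit_left {ε ω} h x := by
    cases ε <;> [skip; exact (not_odd h).elim]
    exact unit_left ω x
  unit_right {ε ω} h x := by
    cases ε <;> [skip; exact (not_odd h).elim]
    exact unit_right ω x

end Ungraded

end TwistedRep

/-! ### Induction from `H` to the ungraded group `G = ker π` -/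

section Induction

variable {k : Type*} [Field k] {Γ : Type*} [Group Γ] {π : Γ →* ℤˣ}

/-- A complete set of representatives of the left cosets of `H` in `G = ker π`. -/
structure CosetReps (π : Γ →* ℤˣ) (H : Subgroup Γ) (ι : Type*) where
  rep : ι → π.ker
  existsUnique : ∀ g : π.ker, ∃! i, (rep i : Γ)⁻¹ * g ∈ H

namespace CosetReps

variable {H : Subgroup Γ} {ι : Type*} (R : CosetReps π H ι)

lemma exists_idx (g : π.ker) (j : ι) : ∃ i, (R.rep j : Γ)⁻¹ * g * R.rep i ∈ H := by
  obtain ⟨i, hi, -⟩ := R.existsUnique (g⁻¹ * R.rep j)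
  refine ⟨i, ?_⟩
  have := H.inv_mem hi
  simpa [mul_assoc] using this

/-- The index `i` with `g rᵢ ∈ rⱼ H`. -/
noncomputable def idx (g : π.ker) (j : ι) : ι := (R.exists_idx g j).choose

/-- The element `h ∈ H` with `g rᵢ = rⱼ h`, where `i = idx g j`. -/
noncomputable def coef (g : π.ker) (j : ι) : H :=
  ⟨(R.rep j : Γ)⁻¹ * g * R.rep (R.idx g j), (R.exists_idx g j).choose_spec⟩

lemma rep_mul_coef (g : π.ker) (j : ι) :
    (g : Γ) * R.rep (R.idx g j) = R.rep j * R.coef g j := by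
  simp [coef, mul_assoc]

lemma idx_unique {g : π.ker} {j i : ι} (h : (R.rep j : Γ)⁻¹ * g * R.rep i ∈ H) :
    R.idx g j = i := by
  refine (R.existsUnique (g⁻¹ * R.rep j)).unique ?_ ?_
  · have := H.inv_mem (show (R.rep j : Γ)⁻¹ * g * R.rep (R.idx g j) ∈ H from (R.coef g j).2)
    simpa [mul_assoc] using this
  · simpa [mul_assoc] using H.inv_mem h

lemma idx_mul {g₂ g₁ g : π.ker} (m : g₂ * g₁ = g) (j : ι) :
    R.idx g₁ (R.idx g₂ j) = R.idx g j := by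
  subst m
  refine (R.idx_unique ?_).symm
  have := H.mul_mem (R.coef g₂ j).2 (R.coef g₁ (R.idx g₂ j)).2
  simpa [coef, mul_assoc] using this

lemma coef_mul {g₂ g₁ g : π.ker} (m : g₂ * g₁ = g) (j : ι) :
    R.coef g₂ j * R.coef g₁ (R.idx g₂ j) = R.coef g j := by
  apply Subtype.ext
  simp only [coef, Subgroup.coe_mul, ← R.idx_mul m]
  simp [← m, mul_assoc]

lemma idx_one (j : ι) : R.idx 1 j = j := R.idx_unique (by simp)

lemma coef_one (j : ι) : R.coef 1 j = 1 := by
  apply Subtype.ext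
  simp [coef, R.idx_one]

end CosetReps

namespace TwistedRep

variable {α : TwistedCocycle k π} {H : Subgroup Γ} {hH : H ≤ π.ker} {ι : Type*}
  {V : Type u} [Category.{v} V] [Preadditive V] [Linear k V]

/-- The functor `Ind(ρ)(g)` on `∏_{G/H} V`, with `(Ind(ρ)(g) x)_j = ρ(h)(xᵢ)` for
`g rᵢ = rⱼ h`. -/
noncomputable def indFun (ρ : TwistedRep 1 (α.res hH) V) (R : CosetReps π H ι) (g : π.ker) :
    (ι → V) ⥤ (ι → V) where
  obj x j := (ρ.fn (R.coef g j)).obj (x (R.idx g j))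
  map f j := (ρ.fn (R.coef g j)).map (f (R.idx g j))
  map_id _ := funext fun _ => (ρ.fn _).map_id _
  map_comp _ _ := funext fun _ => (ρ.fn _).map_comp _ _

/-- The isomorphism `ψ_{h₂,h₁}` at `xᵢ`, followed by the identification of `xᵢ` and `xᵢ'` for
equal indices `i` and `i'`. -/
def mulIsoIdx (ρ : TwistedRep 1 (α.res hH) V) {h₂ h₁ h : H} (m : h₂ * h₁ = h) (x : ι → V)
    {i i' : ι} (e : i = i') : (ρ.fn h₂).obj ((ρ.fn h₁).obj (x i)) ≅ (ρ.fn h).obj (x i') :=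
  ρ.mulIso m (x i) ≪≫ (ρ.fn h).mapIso (eqToIso (congrArg x e))

/-- The scalar `α([g₂|rⱼ|h₁]) / (α([g₂|g₁|rᵢ]) α([r_l|h₂|h₁]))`, where `g₁ rᵢ = rⱼ h₁` and
`g₂ rⱼ = r_l h₂`. -/
noncomputable def indCoeff (α : TwistedCocycle k π) (R : CosetReps π H ι) (g₂ g₁ : π.ker)
    (l : ι) : kˣ :=
  α.coeff g₂ g₁ (R.rep l) (R.rep (R.idx g₂ l)) (R.rep (R.idx g₁ (R.idx g₂ l)))
    (R.coef g₂ l) (R.coef g₁ (R.idx g₂ l))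

/-- The isomorphism `Ind(ψ)_{g₂,g₁}`. For `g₁ rᵢ = rⱼ h₁` and `g₂ rⱼ = r_l h₂`, the component at
the coset of `r_l` is
`α([g₂|rⱼ|h₁]) / (α([g₂|g₁|rᵢ]) α([r_l|h₂|h₁])) ψ_{h₂,h₁}`. -/
noncomputable def indMul (ρ : TwistedRep 1 (α.res hH) V) (R : CosetReps π H ι) {g₂ g₁ g : π.ker}
    (m : g₂ * g₁ = g) (x : ι → V) :
    (ρ.indFun R g₂).obj ((ρ.indFun R g₁).obj x) ≅ (ρ.indFun R g).obj x :=
  Pi.isoMk fun l =>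
    scaleIso (indCoeff α R g₂ g₁ l) (ρ.mulIsoIdx (R.coef_mul m l) x (R.idx_mul m l))

lemma indCoeff_assoc (α : TwistedCocycle k π) (hH : H ≤ π.ker) (R : CosetReps π H ι)
    (g₃ g₂ g₁ : π.ker) (l : ι) :
    α g₃ g₂ g₁ * indCoeff α R g₃ g₂ l * indCoeff α R (g₃ * g₂) g₁ l =
      (α.res hH) (R.coef g₃ l) (R.coef g₂ (R.idx g₃ l)) (R.coef g₁ (R.idx g₂ (R.idx g₃ l))) *
        indCoeff α R g₂ g₁ (R.idx g₃ l) * indCoeff α R g₃ (g₂ * g₁) l := by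
  have h := α.coeff_assoc (R.rep_mul_coef g₁ (R.idx g₂ (R.idx g₃ l)))
    (R.rep_mul_coef g₂ (R.idx g₃ l)) (R.rep_mul_coef g₃ l)
  rw [show π (R.rep l) = 1 from (R.rep l).2, show π g₃ = 1 from g₃.2] at h
  simpa only [indCoeff, ← R.coef_mul (rfl : g₃ * g₂ = g₃ * g₂),
    ← R.idx_mul (rfl : g₃ * g₂ = g₃ * g₂), ← R.coef_mul (rfl : g₂ * g₁ = g₂ * g₁),
    ← R.idx_mul (rfl : g₂ * g₁ = g₂ * g₁), Units.val_one, zpow_one,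
    Subgroup.coe_mul, TwistedCocycle.res_toFun] using h

/-- The isomorphism `ψe` at `xᵢ`, with the identification of `xᵢ` and `xᵢ'` for equal indices
`i` and `i'`. -/
def oneIsoIdx (ρ : TwistedRep 1 (α.res hH) V) {h : H} (hh : h = 1) (x : ι → V) {i i' : ι}
    (e : i = i') : (ρ.fn h).obj (x i) ≅ x i' :=
  eqToIso (by rw [hh]) ≪≫ ρ.oneIso.app (x i) ≪≫ eqToIso (congrArg x e)

lemma mulIsoIdx_nat (ρ : TwistedRep 1 (α.res hH) V) {h₂ h₁ h : H} (m : h₂ * h₁ = h) {x y : ι → V}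
    (f : x ⟶ y) {i i' : ι} (e : i = i') :
    (ρ.fn h₂).map ((ρ.fn h₁).map (f i)) ≫ (ρ.mulIsoIdx m y e).hom =
      (ρ.mulIsoIdx m x e).hom ≫ (ρ.fn h).map (f i') := by
  subst e
  simp [mulIsoIdx, mulIso_nat]

lemma mulIsoIdx_assoc (ρ : TwistedRep 1 (α.res hH) V) (c : ι → H) (d : ι → ι)
    {j j' i i' : ι} {h₃ h₂ h₃₂ h₂₁ h : H} (m₃₂ : h₃ * h₂ = h₃₂) (m₂₁ : h₂ * c j = h₂₁)
    (m : h₃₂ * c j' = h) (m' : h₃ * h₂₁ = h) (x : ι → V) (ej : j = j') (e₁ : d j = i)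
    (e₂ : d j' = i') (e₃ : i = i') :
    (α h₃ h₂ (c j) : k) •
        ((ρ.mulIsoIdx m₃₂ (fun j => (ρ.fn (c j)).obj (x (d j))) ej).hom ≫
          (ρ.mulIsoIdx m x e₂).hom) =
      (ρ.fn h₃).map (ρ.mulIsoIdx m₂₁ x e₁).hom ≫ (ρ.mulIsoIdx m' x e₃).hom := by
  subst ej e₁ e₃
  simpa [mulIsoIdx] using ρ.mulIso_assoc m₃₂ m₂₁ m m' (x (d j))

lemma oneIsoIdx_nat (ρ : TwistedRep 1 (α.res hH) V) {h : H} (hh : h = 1) {x y : ι → V}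
    (f : x ⟶ y) {i i' : ι} (e : i = i') :
    (ρ.fn h).map (f i) ≫ (ρ.oneIsoIdx hh y e).hom = (ρ.oneIsoIdx hh x e).hom ≫ f i' := by
  subst hh e
  simp [oneIsoIdx]

lemma mulIsoIdx_one_left (ρ : TwistedRep 1 (α.res hH) V) (c : ι → H) (d : ι → ι) {j j' : ι}
    {h : H} (hh : h = 1) (m : h * c j = c j') (x : ι → V) (e : j = j') (e₁ : d j = d j') :
    ρ.mulIsoIdx m x e₁ = ρ.oneIsoIdx hh (fun j => (ρ.fn (c j)).obj (x (d j))) e := by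
  subst hh e
  have := ρ.oneIso_left (c j) (x (d j))
  ext
  simp [mulIsoIdx, oneIsoIdx, this]

lemma mulIsoIdx_one_right (ρ : TwistedRep 1 (α.res hH) V) {g h : H} (hh : h = 1)
    (m : g * h = g) (x : ι → V) {i i' : ι} (e : i = i') :
    ρ.mulIsoIdx m x e = (ρ.fn g).mapIso (ρ.oneIsoIdx hh x e) := by
  subst hh e
  have := ρ.oneIso_right g (x i)
  ext
  simp [mulIsoIdx, oneIsoIdx, this]

/-- The induced representation `Ind_H^G(ρ)` of `G = ker π` on `∏_{G/H} V`. -/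
noncomputable def ind (ρ : TwistedRep 1 (α.res hH) V) (R : CosetReps π H ι) :
    TwistedRep (1 : π.ker →* ℤˣ) (α.res le_rfl) (ι → V) :=
  ofUngraded (ρ.indFun R)
    (fun g => ⟨⟨fun {_ _ _ _} => funext fun _ => (ρ.fn _).map_add⟩,
      ⟨fun _ _ => funext fun _ => (ρ.fn _).map_smul _ _⟩⟩)
    (ρ.indMul R)
    (NatIso.ofComponents
      (fun x => Pi.isoMk fun l => ρ.oneIsoIdx (R.coef_one l) x (R.idx_one l))
      (fun f => funext fun l => ρ.oneIsoIdx_nat (R.coef_one l) f (R.idx_one l)))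
    (fun m x y f => funext fun l => by
      have := ρ.mulIsoIdx_nat (R.coef_mul m l) f (R.idx_mul m l)
      simp only [indMul, indFun, Pi.comp_apply, Pi.isoMk_hom, scaleIso_hom, Linear.comp_smul,
        Linear.smul_comp, this])
    (fun {g₃ g₂ g₁ g₃₂ g₂₁ g} m₃₂ m₂₁ m m' x => funext fun l => by
      have h₁ := ρ.mulIsoIdx_assoc (R.coef g₁) (R.idx g₁) (R.coef_mul m₃₂ l)
        (R.coef_mul m₂₁ (R.idx g₃ l)) (R.coef_mul m l) (R.coef_mul m' l) x (R.idx_mul m₃₂ l)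
        (R.idx_mul m₂₁ (R.idx g₃ l)) (R.idx_mul m l) (R.idx_mul m' l)
      have h₂ := congrArg Units.val (indCoeff_assoc α hH R g₃ g₂ g₁ l)
      subst m₃₂ m₂₁
      push_cast at h₂
      refine (pi_smul_apply _ _ _).trans ?_
      simp only [Pi.comp_apply, indMul, indFun, Pi.isoMk_hom, scaleIso_hom, Linear.comp_smul,
        Linear.smul_comp, Functor.map_smul, ← h₁, smul_smul, TwistedCocycle.res_toFun] at h₂ ⊢
      refine (smul_smul _ _ _).trans ?_
      congr 1
      linear_combination h₂)
    (fun g x => Iso.ext <| funext fun l => by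
      have := ρ.mulIsoIdx_one_left (R.coef g) (R.idx g) (R.coef_one l) (R.coef_mul (one_mul g) l) x
        (R.idx_one l) (R.idx_mul (one_mul g) l)
      simp [indMul, this, indFun, indCoeff, TwistedCocycle.coeff, R.coef_one])
    (fun g x => Iso.ext <| funext fun l => by
      have := ρ.mulIsoIdx_one_right (R.coef_one (R.idx g l)) (R.coef_mul (mul_one g) l) x
        (R.idx_mul (mul_one g) l)
      simp [indMul, this, indFun, indCoeff, TwistedCocycle.coeff, R.coef_one])

end TwistedRep

end Induction

/-! ### Hyperbolic induction from the ungraded group `G = ker π` -/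

section Hyperbolic

variable {k : Type*} [Field k] {Γ : Type*} [Group Γ] {π : Γ →* ℤˣ} {ς : Γ}

/-- `g`, for `g` of degree `1`, as an element of `G`. -/
def evenElt {ω : Γ} (h : π ω = Parity.even.sign) : π.ker := ⟨ω, h⟩

/-- `ς⁻¹ g ς`, for `g` of degree `1`, as an element of `G`. -/
def conjElt (hς : π ς = -1) {ω : Γ} (h : π ω = Parity.even.sign) : π.ker :=
  ⟨ς⁻¹ * ω * ς, by
    have h' : π ω = 1 := h
    simp [MonoidHom.mem_ker, hς, h']⟩

lemma conjElt_one (hς : π ς = -1) : conjElt hς (sign_one π) = 1 :=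
  Subtype.ext (by simp [conjElt])

/-- `ω ς`, for `ω` of degree `-1`, as an element of `G`. -/
def mulElt (hς : π ς = -1) {ω : Γ} (h : π ω = Parity.odd.sign) : π.ker :=
  ⟨ω * ς, by
    have h' : π ω = -1 := h
    simp [MonoidHom.mem_ker, hς, h']⟩

/-- `ς⁻¹ ω`, for `ω` of degree `-1`, as an element of `G`. -/
def invMulElt (hς : π ς = -1) {ω : Γ} (h : π ω = Parity.odd.sign) : π.ker :=
  ⟨ς⁻¹ * ω, by
    have h' : π ω = -1 := h
    simp [MonoidHom.mem_ker, hς, h']⟩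

namespace TwistedCocycle

/-- The associativity of the scalars `coeff` for `ηᵢ = sᵢ⁻¹ ωᵢ sᵢ₋₁`. -/
lemma hyp_coeff (α : TwistedCocycle k π) (ω₃ ω₂ ω₁ s₃ s₂ s₁ s₀ : Γ) :
    α ω₃ ω₂ ω₁ * α.coeff ω₃ ω₂ s₃ s₂ s₁ (s₃⁻¹ * (ω₃ * s₂)) (s₂⁻¹ * (ω₂ * s₁)) *
        α.coeff (ω₃ * ω₂) ω₁ s₃ s₁ s₀ (s₃⁻¹ * (ω₃ * (ω₂ * s₁))) (s₁⁻¹ * (ω₁ * s₀)) =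
      α (s₃⁻¹ * (ω₃ * s₂)) (s₂⁻¹ * (ω₂ * s₁)) (s₁⁻¹ * (ω₁ * s₀)) ^ ((π s₃ : ℤˣ) : ℤ) *
        α.coeff ω₂ ω₁ s₂ s₁ s₀ (s₂⁻¹ * (ω₂ * s₁)) (s₁⁻¹ * (ω₁ * s₀)) ^ ((π ω₃ : ℤˣ) : ℤ) *
        α.coeff ω₃ (ω₂ * ω₁) s₃ s₂ s₀ (s₃⁻¹ * (ω₃ * s₂)) (s₂⁻¹ * (ω₂ * (ω₁ * s₀))) := by
  have h := α.coeff_assoc (show ω₁ * s₀ = s₁ * (s₁⁻¹ * (ω₁ * s₀)) by simp)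
    (show ω₂ * s₁ = s₂ * (s₂⁻¹ * (ω₂ * s₁)) by simp)
    (show ω₃ * s₂ = s₃ * (s₃⁻¹ * (ω₃ * s₂)) by simp)
  simpa only [mul_assoc, mul_inv_cancel_left] using h

end TwistedCocycle

namespace TwistedRep

variable {α : TwistedCocycle k π} {W : Type u} [Category.{v} W] [Preadditive W] [Linear k W]

/-- The signed endofunctor of `W × Wᵒᵖ` by which `ω` acts on the hyperbolic representation:
`ρ(ω) × ρ(ς⁻¹ως)ᵒᵖ` for `π(ω) = 1`, and `(x, y) ↦ (ρ(ως) y, ρ(ς⁻¹ω)ᵒᵖ x)` for `π(ω) = -1`. -/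
def hypAct (ρ : TwistedRep (1 : π.ker →* ℤˣ) (α.res le_rfl) W) (hς : π ς = -1) :
    {ε : Parity} → {ω : Γ} → π ω = ε.sign → SignedEnd (W × Wᵒᵖ) ε
  | .even, _, h => show (W × Wᵒᵖ) ⥤ (W × Wᵒᵖ) from
      (ρ.fn (evenElt h)).prod (ρ.fn (conjElt hς h)).op
  | .odd, _, h => show (W × Wᵒᵖ)ᵒᵖ ⥤ (W × Wᵒᵖ) from
      { obj := fun X => ((ρ.fn (mulElt hς h)).obj X.unop.2.unop,
          op ((ρ.fn (invMulElt hς h)).obj X.unop.1))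
        map := fun f => Prod.mkHom ((ρ.fn (mulElt hς h)).map f.unop.2.unop)
          ((ρ.fn (invMulElt hς h)).map f.unop.1).op
        map_id := fun _ => Prod.ext ((ρ.fn _).map_id _)
          (Quiver.Hom.unop_inj ((ρ.fn _).map_id _))
        map_comp := fun _ _ => Prod.ext ((ρ.fn _).map_comp _ _)
          (Quiver.Hom.unop_inj ((ρ.fn _).map_comp _ _)) }

/-- An isomorphism in `W × Wᵒᵖ` from isomorphisms of the components in `W`; the second component
is `e₂⁻ᵒᵖ`. -/
def hypIso {x y : W} {x' y' : W} (e₁ : x ≅ y) (e₂ : x' ≅ y') :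
    ((x, op x') : W × Wᵒᵖ) ≅ (y, op y') :=
  Iso.prod e₁ e₂.symm.op

/-- The isomorphism `HInd(ψ)_{ω₂,ω₁}`. On the first factor it is a multiple of `ψ`, on the second
a multiple of `ψ⁻ᵒᵖ` (so that the scalar of `ψ` in `e₂` is the inverse of that of `ψ⁻ᵒᵖ`). -/
def hypMul (ρ : TwistedRep (1 : π.ker →* ℤˣ) (α.res le_rfl) W) (hς : π ς = -1) :
    {ε₂ ε₁ ε : Parity} → {ω₂ ω₁ ω : Γ} → (h₂ : π ω₂ = ε₂.sign) → (h₁ : π ω₁ = ε₁.sign) →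
      (h : π ω = ε.sign) → ω₂ * ω₁ = ω → (X : W × Wᵒᵖ) →
        ((ρ.hypAct hς h₂).obj ((ρ.hypAct hς h₁).obj X) ≅ (ρ.hypAct hς h).obj X)
  | .even, .even, .even, ω₂, ω₁, ω, h₂, h₁, h, m, X =>
      hypIso
        (scaleIso (1 : kˣ)
          (ρ.mulIso (Subtype.ext m : evenElt h₂ * evenElt h₁ = evenElt h) X.1))
        (scaleIso (α ω₂ ς (ς⁻¹ * ω₁ * ς) / (α ω₂ ω₁ ς * α ς (ς⁻¹ * ω₂ * ς) (ς⁻¹ * ω₁ * ς)))⁻¹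
          (ρ.mulIso (Subtype.ext (by simp [conjElt, ← m, mul_assoc]) :
            conjElt hς h₂ * conjElt hς h₁ = conjElt hς h) X.2.unop))
  | .odd, .even, .odd, ω₂, ω₁, ω, h₂, h₁, h, m, X =>
      hypIso
        (scaleIso (α ω₂ ς (ς⁻¹ * ω₁ * ς) / α ω₂ ω₁ ς)
          (ρ.mulIso (Subtype.ext (by simp [mulElt, conjElt, ← m, mul_assoc]) :
            mulElt hς h₂ * conjElt hς h₁ = mulElt hς h) X.2.unop))
        (scaleIso ((α ς (ς⁻¹ * ω₂) ω₁)⁻¹)⁻¹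
          (ρ.mulIso (Subtype.ext (by simp [invMulElt, evenElt, ← m, mul_assoc]) :
            invMulElt hς h₂ * evenElt h₁ = invMulElt hς h) X.1))
  | .even, .odd, .odd, ω₂, ω₁, ω, h₂, h₁, h, m, X =>
      hypIso
        (scaleIso (α ω₂ ω₁ ς)⁻¹
          (ρ.mulIso (Subtype.ext (by simp [evenElt, mulElt, ← m, mul_assoc]) :
            evenElt h₂ * mulElt hς h₁ = mulElt hς h) X.2.unop))
        (scaleIso (α ω₂ ς (ς⁻¹ * ω₁) / α ς (ς⁻¹ * ω₂ * ς) (ς⁻¹ * ω₁))⁻¹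
          (ρ.mulIso (Subtype.ext (by simp [conjElt, invMulElt, ← m, mul_assoc]) :
            conjElt hς h₂ * invMulElt hς h₁ = invMulElt hς h) X.1))
  | .odd, .odd, .even, ω₂, ω₁, ω, h₂, h₁, h, m, X =>
      hypIso
        (scaleIso (α ω₂ ς (ς⁻¹ * ω₁))
          (ρ.mulIso (Subtype.ext (by simp [mulElt, invMulElt, evenElt, ← m, mul_assoc]) :
            mulElt hς h₂ * invMulElt hς h₁ = evenElt h) X.1))
        (scaleIso ((α ω₂ ω₁ ς * α ς (ς⁻¹ * ω₂) (ω₁ * ς))⁻¹)⁻¹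
          (ρ.mulIso (Subtype.ext (by simp [invMulElt, mulElt, conjElt, ← m, mul_assoc]) :
            invMulElt hς h₂ * mulElt hς h₁ = conjElt hς h) X.2.unop))
  | .even, .even, .odd, _, _, _, h₂, h₁, h, m, _ => False.elim <| by
      rw [← m, map_mul, h₂, h₁] at h; exact absurd h (by decide)
  | .even, .odd, .even, _, _, _, h₂, h₁, h, m, _ => False.elim <| by
      rw [← m, map_mul, h₂, h₁] at h; exact absurd h (by decide)
  | .odd, .even, .even, _, _, _, h₂, h₁, h, m, _ => False.elim <| by
      rw [← m, map_mul, h₂, h₁] at h; exact absurd h (by decide)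
  | .odd, .odd, .odd, _, _, _, h₂, h₁, h, m, _ => False.elim <| by
      rw [← m, map_mul, h₂, h₁] at h; exact absurd h (by decide)

lemma parity_absurd {ω₂ ω₁ ω : Γ} {ε₂ ε₁ ε : Parity} (h₂ : π ω₂ = ε₂.sign) (h₁ : π ω₁ = ε₁.sign)
    (h : π ω = ε.sign) (m : ω₂ * ω₁ = ω) (hε : ε₂.sign * ε₁.sign ≠ ε.sign) : False := by
  rw [← m, map_mul, h₂, h₁] at h
  exact hε h

lemma hyp_assoc (ρ : TwistedRep (1 : π.ker →* ℤˣ) (α.res le_rfl) W) (hς : π ς = -1)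
    {ε₃ ε₂ ε₁ ε₃₂ ε₂₁ ε : Parity} {ω₃ ω₂ ω₁ ω₃₂ ω₂₁ ω : Γ}
    (h₃ : π ω₃ = ε₃.sign) (h₂ : π ω₂ = ε₂.sign) (h₁ : π ω₁ = ε₁.sign)
    (h₃₂ : π ω₃₂ = ε₃₂.sign) (h₂₁ : π ω₂₁ = ε₂₁.sign) (h : π ω = ε.sign)
    (m₃₂ : ω₃ * ω₂ = ω₃₂) (m₂₁ : ω₂ * ω₁ = ω₂₁) (m : ω₃₂ * ω₁ = ω) (m' : ω₃ * ω₂₁ = ω)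
    (X : W × Wᵒᵖ) :
    (α ω₃ ω₂ ω₁ : k) • ((ρ.hypMul hς h₃ h₂ h₃₂ m₃₂ ((ρ.hypAct hς h₁).obj X)).hom ≫
        (ρ.hypMul hς h₃₂ h₁ h m X).hom) =
      ((ρ.hypAct hς h₃).mapIso (ρ.hypMul hς h₂ h₁ h₂₁ m₂₁ X)).hom ≫
        (ρ.hypMul hς h₃ h₂₁ h m' X).hom := by
  cases ε₃ <;> cases ε₂ <;> cases ε₁ <;> cases ε₃₂ <;> cases ε₂₁ <;> cases ε <;>
    first
    | exact (parity_absurd h₃ h₂ h₃₂ m₃₂ (by decide)).elim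
    | exact (parity_absurd h₂ h₁ h₂₁ m₂₁ (by decide)).elim
    | exact (parity_absurd h₃ h₂₁ h m' (by decide)).elim
    | skip
  all_goals
    subst m₃₂ m₂₁
    refine Prod.ext (ρ.mulIso_assoc_scaled (a := α ω₃ ω₂ ω₁) _ _ _ _ _ ?_)
      (Quiver.Hom.unop_inj (ρ.mulIso_assoc_scaled_inv (a := α ω₃ ω₂ ω₁) _ _ _ _ _ ?_))
  all_goals simp only [evenElt, conjElt, mulElt, invMulElt, TwistedCocycle.res_toFun]
  on_goal 1 => have h := congrArg Additive.ofMul (α.hyp_coeff ω₃ ω₂ ω₁ ς ς ς ς)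
  on_goal 2 => have h := congrArg Additive.ofMul (α.hyp_coeff ω₃ ω₂ ω₁ 1 1 1 ς)
  on_goal 3 => have h := congrArg Additive.ofMul (α.hyp_coeff ω₃ ω₂ ω₁ ς ς ς 1)
  on_goal 4 => have h := congrArg Additive.ofMul (α.hyp_coeff ω₃ ω₂ ω₁ 1 1 ς ς)
  on_goal 5 => have h := congrArg Additive.ofMul (α.hyp_coeff ω₃ ω₂ ω₁ ς ς 1 1)
  on_goal 6 => have h := congrArg Additive.ofMul (α.hyp_coeff ω₃ ω₂ ω₁ 1 1 ς 1)
  on_goal 7 => have h := congrArg Additive.ofMul (α.hyp_coeff ω₃ ω₂ ω₁ ς ς 1 ς)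
  on_goal 8 => have h := congrArg Additive.ofMul (α.hyp_coeff ω₃ ω₂ ω₁ 1 ς ς ς)
  on_goal 9 => have h := congrArg Additive.ofMul (α.hyp_coeff ω₃ ω₂ ω₁ ς 1 1 1)
  on_goal 10 => have h := congrArg Additive.ofMul (α.hyp_coeff ω₃ ω₂ ω₁ 1 ς ς 1)
  on_goal 11 => have h := congrArg Additive.ofMul (α.hyp_coeff ω₃ ω₂ ω₁ ς 1 1 ς)
  on_goal 12 => have h := congrArg Additive.ofMul (α.hyp_coeff ω₃ ω₂ ω₁ 1 ς 1 1)
  on_goal 13 => have h := congrArg Additive.ofMul (α.hyp_coeff ω₃ ω₂ ω₁ ς 1 ς ς)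
  on_goal 14 => have h := congrArg Additive.ofMul (α.hyp_coeff ω₃ ω₂ ω₁ 1 ς 1 ς)
  on_goal 15 => have h := congrArg Additive.ofMul (α.hyp_coeff ω₃ ω₂ ω₁ ς 1 ς 1)
  all_goals
    apply Additive.ofMul.injective
    simp only [TwistedCocycle.coeff, h₃, hς, map_one, Parity.sign, ofMul_mul, ofMul_div, ofMul_zpow,
      ofMul_inv, mul_assoc, mul_one, one_mul, inv_one, Units.val_one, Units.val_neg,
      TwistedCocycle.one_left, TwistedCocycle.one_mid, TwistedCocycle.one_right, ofMul_one] at h ⊢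
    first
    | linear_combination (norm := module) h
    | linear_combination (norm := module) (-1 : ℤ) • h

/-- The hyperbolically induced representation `HInd_G^Γ(ρ)` on `W × Wᵒᵖ`, formed with an element
`ς` of degree `-1`. -/
def hInd (ρ : TwistedRep (1 : π.ker →* ℤˣ) (α.res le_rfl) W) (hς : π ς = -1) :
    TwistedRep π α (W × Wᵒᵖ) where
  act h := ρ.hypAct hς h
  linear {ε ω} h :=
    match ε, h with
    | .even, _ =>
      ⟨⟨fun {_ _ _ _} => Prod.ext ((ρ.fn _).map_add)
          (Quiver.Hom.unop_inj ((ρ.fn _).map_add))⟩,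
        ⟨fun _ _ => Prod.ext ((ρ.fn _).map_smul _ _)
          (Quiver.Hom.unop_inj ((ρ.fn _).map_smul _ _))⟩⟩
    | .odd, _ =>
      ⟨⟨fun {_ _ _ _} => Prod.ext ((ρ.fn _).map_add)
          (Quiver.Hom.unop_inj ((ρ.fn _).map_add))⟩,
        ⟨fun _ _ => Prod.ext ((ρ.fn _).map_smul _ _)
          (Quiver.Hom.unop_inj ((ρ.fn _).map_smul _ _))⟩⟩
  ψ h₂ h₁ h m X := ρ.hypMul hς h₂ h₁ h m X
  ψe := NatIso.ofComponents
    (fun X => hypIso (ρ.oneIsoOf rfl X.1) (ρ.oneIsoOf (conjElt_one hς) X.2.unop))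
    (fun f => Prod.ext (ρ.oneIsoOf_nat rfl _)
      (Quiver.Hom.unop_inj (ρ.oneIsoOf_inv_nat (conjElt_one hς) _).symm))
  nat_even_even _ _ _ _ _ _ _ := Prod.ext (ρ.scale_mulIso_nat _ _ _)
    (Quiver.Hom.unop_inj (ρ.scale_mulIso_inv_nat _ _ _))
  nat_even_odd _ _ _ _ _ _ _ := Prod.ext (ρ.scale_mulIso_nat _ _ _)
    (Quiver.Hom.unop_inj (ρ.scale_mulIso_inv_nat _ _ _))
  nat_odd_even _ _ _ _ _ _ _ := Prod.ext (ρ.scale_mulIso_nat _ _ _)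
    (Quiver.Hom.unop_inj (ρ.scale_mulIso_inv_nat _ _ _))
  nat_odd_odd _ _ _ _ _ _ _ := Prod.ext (ρ.scale_mulIso_nat _ _ _)
    (Quiver.Hom.unop_inj (ρ.scale_mulIso_inv_nat _ _ _))
  assoc h₃ h₂ h₁ h₃₂ h₂₁ h m₃₂ m₂₁ m m' X := ρ.hyp_assoc hς h₃ h₂ h₁ h₃₂ h₂₁ h m₃₂ m₂₁ m m' X
  unit_left {ε ω} h X := by
    cases ε
    · refine congrArg₂ hypIso (ρ.mulIso_one_left rfl _ ?_ _)
        (ρ.mulIso_one_left (Subtype.ext ?_) _ ?_ _) <;> simp [conjElt]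
    · refine congrArg₂ hypIso (ρ.mulIso_one_left rfl _ ?_ _)
        (ρ.mulIso_one_left (Subtype.ext ?_) _ ?_ _) <;> simp [conjElt]
  unit_right {ε ω} h X := by
    cases ε
    · refine congrArg₂ hypIso (ρ.mulIso_one_right rfl _ ?_ _)
        (ρ.mulIso_one_right (Subtype.ext ?_) _ ?_ _) <;> simp [conjElt]
    · refine congrArg₂ hypIso (ρ.mulIso_one_right (Subtype.ext ?_) _ ?_ _)
        (ρ.mulIso_one_right rfl _ ?_ _) <;> simp [conjElt]

end TwistedRep

end Hyperbolic

/-! ### Categorical traces and Real 2-characters -/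

section Character

variable {k : Type*} [Field k] {Γ : Type*} [Group Γ] {π : Γ →* ℤˣ}

section Squares

variable {C D : Type*} [Category C] [Category D] {X Y Z X' Y' Z' : C}

lemma square_comp {u : X ⟶ X'} {v : Y ⟶ Y'} {w : Z ⟶ Z'} {a : X ⟶ Y} {b : Y ⟶ Z} {a' : X' ⟶ Y'}
    {b' : Y' ⟶ Z'} (h : u ≫ a' = a ≫ v) (h' : v ≫ b' = b ≫ w) :
    u ≫ a' ≫ b' = (a ≫ b) ≫ w := by
  rw [reassoc_of% h, h', Category.assoc]

lemma square_inv {u : X ⟶ X'} {v : Y ⟶ Y'} {a : X ≅ Y} {a' : X' ≅ Y'}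
    (h : u ≫ a'.hom = a.hom ≫ v) : v ≫ a'.inv = a.inv ≫ u := by
  rw [Iso.comp_inv_eq, Category.assoc, h, Iso.inv_hom_id_assoc]

lemma square_map (F : C ⥤ D) {u : X ⟶ X'} {v : Y ⟶ Y'} {a : X ⟶ Y} {a' : X' ⟶ Y'}
    (h : u ≫ a' = a ≫ v) : F.map u ≫ F.map a' = F.map a ≫ F.map v := by
  rw [← F.map_comp, h, F.map_comp]

lemma square_map_op (F : Cᵒᵖ ⥤ D) {u : X ⟶ X'} {v : Y ⟶ Y'} {a : X ⟶ Y} {a' : X' ⟶ Y'}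
    (h : u ≫ a' = a ≫ v) : F.map v.op ≫ F.map a.op = F.map a'.op ≫ F.map u.op := by
  rw [← F.map_comp, ← F.map_comp, ← op_comp, ← op_comp, h]

lemma sandwich_add [Preadditive C] [Preadditive D] (F : C ⥤ D) [F.Additive] {A B : D}
    (p : A ⟶ F.obj X) (f f' : X ⟶ Y) (q : F.obj Y ⟶ B) :
    p ≫ F.map (f + f') ≫ q = p ≫ F.map f ≫ q + p ≫ F.map f' ≫ q := by
  simp

lemma sandwich_smul {k : Type*} [Field k] [Preadditive C] [Preadditive D] [Linear k C] [Linear k D]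
    (F : C ⥤ D) [F.Linear k] {A B : D} (p : A ⟶ F.obj X) (a : k) (f : X ⟶ Y) (q : F.obj Y ⟶ B) :
    p ≫ F.map (a • f) ≫ q = a • (p ≫ F.map f ≫ q) := by
  simp

end Squares

namespace TwistedRep

variable {α : TwistedCocycle k π} {V : Type u} [Category.{v} V] [Preadditive V] [Linear k V]

instance (ρ : TwistedRep π α V) {g : Γ} (h : π g = Parity.even.sign) : (ρ.act h).cov.Additive :=
  (ρ.linear h).1

instance (ρ : TwistedRep π α V) {g : Γ} (h : π g = Parity.even.sign) : (ρ.act h).cov.Linear k :=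
  (ρ.linear h).2

instance (ρ : TwistedRep π α V) {g : Γ} (h : π g = Parity.odd.sign) : (ρ.act h).contra.Additive :=
  (ρ.linear h).1

instance (ρ : TwistedRep π α V) {g : Γ} (h : π g = Parity.odd.sign) : (ρ.act h).contra.Linear k :=
  (ρ.linear h).2

/-- The categorical trace `Tr_ρ(g) = Hom(1_V, ρ(g))`, for `g ∈ G`. -/
abbrev Tr (ρ : TwistedRep π α V) {g : Γ} (hg : π g = Parity.even.sign) : Type (max u v) :=
  𝟭 V ⟶ (ρ.act hg).cov

/-- The isomorphism `ρ(ω)(ρ(ω⁻¹) x) ≅ ρ(1) x ≅ x`. -/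
def invIso (ρ : TwistedRep π α V) {ω : Γ} {ε : Parity} (h : π ω = ε.sign) (x : V) :
    (ρ.act h).obj ((ρ.act (sign_inv h)).obj x) ≅ x :=
  ρ.ψ h (sign_inv h) (sign_one π) (mul_inv_cancel ω) x ≪≫ ρ.ψe.app x

lemma invIso_nat_even (ρ : TwistedRep π α V) {ω : Γ} (h : π ω = Parity.even.sign) {x y : V}
    (f : x ⟶ y) :
    (ρ.act h).cov.map ((ρ.act (sign_inv h)).cov.map f) ≫ (ρ.invIso h y).hom =
      (ρ.invIso h x).hom ≫ f := by
  exact square_comp (ρ.nat_even_even h (sign_inv h) (sign_one π) (mul_inv_cancel ω) f)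
    (ρ.ψe.hom.naturality f)

lemma invIso_nat_odd (ρ : TwistedRep π α V) {ω : Γ} (h : π ω = Parity.odd.sign) {x y : V}
    (f : x ⟶ y) :
    (ρ.act h).contra.map ((ρ.act (sign_inv h)).contra.map f.op).op ≫ (ρ.invIso h y).hom =
      (ρ.invIso h x).hom ≫ f := by
  exact square_comp (ρ.nat_odd_odd h (sign_inv h) (sign_one π) (mul_inv_cancel ω) f)
    (ρ.ψe.hom.naturality f)

/-- For `φ : 1_V ⟹ ρ(g)`, the natural transformation `ρ(g⁻¹) ⟹ ρ(g⁻¹) ρ(g) ⟹ ρ(1) ⟹ 1_V`. -/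
def mate (ρ : TwistedRep π α V) {g : Γ} {hg : π g = Parity.even.sign} (φ : ρ.Tr hg) (y : V) :
    (ρ.act (sign_inv hg)).cov.obj y ⟶ y :=
  (ρ.act (sign_inv hg)).cov.map (φ.app y) ≫
    (ρ.ψ (sign_inv hg) hg (sign_one π) (inv_mul_cancel g) y).hom ≫ ρ.ψe.hom.app y

lemma mate_nat (ρ : TwistedRep π α V) {g : Γ} {hg : π g = Parity.even.sign} (φ : ρ.Tr hg)
    {x y : V} (f : x ⟶ y) :
    (ρ.act (sign_inv hg)).cov.map f ≫ ρ.mate φ y = ρ.mate φ x ≫ f := by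
  exact square_comp (square_map _ (φ.naturality f))
    (square_comp (ρ.nat_even_even (sign_inv hg) hg (sign_one π) (inv_mul_cancel g) f)
      (ρ.ψe.hom.naturality f))

lemma mate_add (ρ : TwistedRep π α V) {g : Γ} {hg : π g = Parity.even.sign} (φ φ' : ρ.Tr hg)
    (y : V) : ρ.mate (φ + φ') y = ρ.mate φ y + ρ.mate φ' y := by
  simp [mate]

lemma mate_smul (ρ : TwistedRep π α V) {g : Γ} {hg : π g = Parity.even.sign} (a : k)
    (φ : ρ.Tr hg) (y : V) : ρ.mate (a • φ) y = a • ρ.mate φ y := by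
  simp [mate]

/-- The component at `x` of the image of `φ` under `β_{g,ω}`, for `π(ω) = 1` and
`g' = ω g ω⁻¹`:
`x ⟶ ρ(ω)ρ(ω⁻¹)x ⟶ ρ(ω)ρ(g)ρ(ω⁻¹)x ⟶ ρ(ωg)ρ(ω⁻¹)x ⟶ ρ(g')ρ(ω)ρ(ω⁻¹)x ⟶ ρ(g')x`. -/
def betaEvenApp (ρ : TwistedRep π α V) {g ω g' : Γ} {hg : π g = Parity.even.sign}
    (hω : π ω = Parity.even.sign) (hg' : π g' = Parity.even.sign) (m : g' * ω = ω * g)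
    (φ : ρ.Tr hg) (x : V) : x ⟶ (ρ.act hg').cov.obj x :=
  have h : π (ω * g) = Parity.even.sign := by rw [map_mul, hω, hg]; rfl
  let y := (ρ.act (sign_inv hω)).cov.obj x
  (ρ.invIso hω x).inv ≫ (ρ.act hω).cov.map (φ.app y) ≫ (ρ.ψ hω hg h rfl y).hom ≫
    (ρ.ψ hg' hω h m y).inv ≫ (ρ.act hg').cov.map (ρ.invIso hω x).hom

/-- The component at `x` of the image of `φ` under `β_{g,ω}`, for `π(ω) = -1` and
`g' = ω g⁻¹ ω⁻¹`:
`x ⟶ ρ(ω)ρ(ω⁻¹)x ⟶ ρ(ω)ρ(g⁻¹)ρ(ω⁻¹)x ⟶ ρ(ωg⁻¹)ρ(ω⁻¹)x ⟶ ρ(g')ρ(ω)ρ(ω⁻¹)x ⟶ ρ(g')x`,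
where the second map is the value of the contravariant functor `ρ(ω)` on `ρ(g⁻¹) ⟹ 1_V`. -/
def betaOddApp (ρ : TwistedRep π α V) {g ω g' : Γ} {hg : π g = Parity.even.sign}
    (hω : π ω = Parity.odd.sign) (hg' : π g' = Parity.even.sign) (m : g' * ω = ω * g⁻¹)
    (φ : ρ.Tr hg) (x : V) : x ⟶ (ρ.act hg').cov.obj x :=
  have h : π (ω * g⁻¹) = Parity.odd.sign := by rw [map_mul, hω, sign_inv hg]; rfl
  let y := (ρ.act (sign_inv hω)).contra.obj (op x)
  (ρ.invIso hω x).inv ≫ (ρ.act hω).contra.map (ρ.mate φ y).op ≫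
    (ρ.ψ hω (sign_inv hg) h rfl y).hom ≫ (ρ.ψ hg' hω h m y).inv ≫
      (ρ.act hg').cov.map (ρ.invIso hω x).hom

lemma betaEvenApp_nat (ρ : TwistedRep π α V) {g ω g' : Γ} {hg : π g = Parity.even.sign}
    (hω : π ω = Parity.even.sign) (hg' : π g' = Parity.even.sign) (m : g' * ω = ω * g)
    (φ : ρ.Tr hg) {x y : V} (f : x ⟶ y) :
    f ≫ ρ.betaEvenApp hω hg' m φ y = ρ.betaEvenApp hω hg' m φ x ≫ (ρ.act hg').cov.map f := by
  have h : π (ω * g) = Parity.even.sign := by rw [map_mul, hω, hg]; rfl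
  let a := (ρ.act (sign_inv hω)).cov.map f
  exact square_comp (square_inv (ρ.invIso_nat_even hω f))
    (square_comp (square_map _ (φ.naturality a))
      (square_comp (ρ.nat_even_even hω hg h rfl a)
        (square_comp (square_inv (ρ.nat_even_even hg' hω h m a))
          (square_map _ (ρ.invIso_nat_even hω f)))))

lemma betaOddApp_nat (ρ : TwistedRep π α V) {g ω g' : Γ} {hg : π g = Parity.even.sign}
    (hω : π ω = Parity.odd.sign) (hg' : π g' = Parity.even.sign) (m : g' * ω = ω * g⁻¹)
    (φ : ρ.Tr hg) {x y : V} (f : x ⟶ y) :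
    f ≫ ρ.betaOddApp hω hg' m φ y = ρ.betaOddApp hω hg' m φ x ≫ (ρ.act hg').cov.map f := by
  have h : π (ω * g⁻¹) = Parity.odd.sign := by rw [map_mul, hω, sign_inv hg]; rfl
  let a := (ρ.act (sign_inv hω)).contra.map f.op
  exact square_comp (square_inv (ρ.invIso_nat_odd hω f))
    (square_comp (square_map_op _ (ρ.mate_nat φ a))
      (square_comp (ρ.nat_odd_even hω (sign_inv hg) h rfl a)
        (square_comp (square_inv (ρ.nat_even_odd hg' hω h m a))
          (square_map _ (ρ.invIso_nat_odd hω f)))))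

/-- The linear map `β_{g,ω} : Tr_ρ(g) ⟶ Tr_ρ(ωgω⁻¹)`, for `π(ω) = 1`. -/
def betaEven (ρ : TwistedRep π α V) {g ω g' : Γ} (hg : π g = Parity.even.sign)
    (hω : π ω = Parity.even.sign) (hg' : π g' = Parity.even.sign) (m : g' * ω = ω * g) :
    ρ.Tr hg →ₗ[k] ρ.Tr hg' where
  toFun φ :=
    { app := ρ.betaEvenApp hω hg' m φ
      naturality := fun _ _ f => ρ.betaEvenApp_nat hω hg' m φ f }
  map_add' φ φ' := NatTrans.ext <| funext fun _ =>
    sandwich_add (ρ.act hω).cov _ (φ.app _) (φ'.app _) _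
  map_smul' a φ := NatTrans.ext <| funext fun _ =>
    sandwich_smul (ρ.act hω).cov _ a (φ.app _) _

/-- The linear map `β_{g,ω} : Tr_ρ(g) ⟶ Tr_ρ(ωg⁻¹ω⁻¹)`, for `π(ω) = -1`. -/
def betaOdd (ρ : TwistedRep π α V) {g ω g' : Γ} (hg : π g = Parity.even.sign)
    (hω : π ω = Parity.odd.sign) (hg' : π g' = Parity.even.sign) (m : g' * ω = ω * g⁻¹) :
    ρ.Tr hg →ₗ[k] ρ.Tr hg' where
  toFun φ :=
    { app := ρ.betaOddApp hω hg' m φ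
      naturality := fun _ _ f => ρ.betaOddApp_nat hω hg' m φ f }
  map_add' φ φ' := NatTrans.ext <| funext fun x => by
    refine Eq.trans ?_ (sandwich_add (ρ.act hω).contra _ (ρ.mate φ _).op (ρ.mate φ' _).op _)
    rw [← op_add, ← mate_add]
    rfl
  map_smul' a φ := NatTrans.ext <| funext fun x => by
    refine Eq.trans ?_ (sandwich_smul (ρ.act hω).contra _ a (ρ.mate φ _).op _)
    rw [← op_smul', ← mate_smul]
    rfl

open Classical in
/-- The Real 2-character `χ_ρ(g, ω)`, the trace of `β_{g,ω}` on `Tr_ρ(g)`, for `g ∈ G` and `ω ∈ Γ`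
with `ω g ^ π(ω) = g ω`. It is meaningful when `Tr_ρ(g)` is finite dimensional. For `π = 1` this is the 2-character. The value is `0` by convention for
other pairs. -/
noncomputable def char (ρ : TwistedRep π α V) (g ω : Γ) : k :=
  if h : π g = 1 ∧ π ω = 1 ∧ g * ω = ω * g then
    LinearMap.trace k (ρ.Tr (g := g) h.1) (ρ.betaEven h.1 h.2.1 h.1 h.2.2)
  else if h : π g = 1 ∧ π ω = -1 ∧ g * ω = ω * g⁻¹ then
    LinearMap.trace k (ρ.Tr (g := g) h.1) (ρ.betaOdd h.1 h.2.1 h.1 h.2.2)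
  else 0

end TwistedRep

/-- The graded commuting pairs: `g ∈ G` and `ω ∈ Γ` with `ω g ^ π(ω) = g ω`. They are the objects
of the loop groupoid of the unoriented loop groupoid of `BΓ`. -/
def GradedCommute (π : Γ →* ℤˣ) (g ω : Γ) : Prop :=
  π g = 1 ∧ ω * g ^ ((π ω : ℤˣ) : ℤ) = g * ω

/-- The Real conjugate `σ g ^ π(σ) σ⁻¹`. -/
def realConj (π : Γ →* ℤˣ) (σ g : Γ) : Γ := σ * g ^ ((π σ : ℤˣ) : ℤ) * σ⁻¹

namespace TwistedCocycle

/-- The reflection twisted transgression of `α`, a 2-cocycle on the groupoid of elements of `G`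
and their Real conjugations by `Γ`. The value `α.transgress ω₂ ω₁ g` is the one on
`[ω₂|ω₁]g`. -/
def transgress (α : TwistedCocycle k π) (ω₂ ω₁ g : Γ) : kˣ :=
  (if π ω₂ = -1 ∧ π ω₁ = -1 then α g g⁻¹ g else 1) *
    (α (realConj π ω₁ g⁻¹) (realConj π ω₁ g) ω₁ *
        α ω₁ (g ^ (-((π ω₁ : ℤˣ) : ℤ))) (g ^ ((π ω₁ : ℤˣ) : ℤ)) /
      α (realConj π ω₁ g⁻¹) ω₁ (g ^ ((π ω₁ : ℤˣ) : ℤ))) ^ ((((π ω₂ : ℤˣ) : ℤ) - 1) / 2) *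
    (α ω₂ ω₁ (g ^ ((π (ω₂ * ω₁) : ℤˣ) : ℤ)) * α (realConj π (ω₂ * ω₁) g) ω₂ ω₁ /
      α ω₂ (ω₁ * g ^ ((π (ω₂ * ω₁) : ℤˣ) : ℤ) * ω₁⁻¹) ω₁)

/-- The further transgression along loops: the value on the morphism `[σ](g, ω)` from the loop
`(g, ω)` to its conjugate by `σ`. -/
def transgress₂ (α : TwistedCocycle k π) (σ g ω : Γ) : kˣ :=
  α.transgress (σ * ω * σ⁻¹) σ g / α.transgress σ ω g

end TwistedCocycle

end Character

end RealTwoRep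

/-!
Transformations `1 ⟹ F × F'ᵒᵖ` on `W × Wᵒᵖ` are pairs of transformations `1 ⟹ F` and `F' ⟹ 1`, and
the latter correspond to transformations `1 ⟹ ρ(b)` when `F' = ρ(b⁻¹)`. Hence `Tr_{HInd(ρ)}(g)` is
the sum of `Tr_ρ(g)` and `Tr_ρ(ς⁻¹g⁻¹ς)`. An odd `ω` exchanges the two summands, so it has trace
zero; an even one preserves them. In the same way `Tr_{Ind(ρ)}(g)` is the sum of the spaces
`Tr_ρ(rⱼ⁻¹grⱼ)` over the fixed cosets `rⱼH` of `g`, and only those also fixed by `ω` contribute to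
the trace.

The scalars relating the blocks to the maps `β` of `ρ` are iterated slant products of the cocycle.
The slant product of a cocycle is again a cocycle, so they are multiplicative in the conjugating
element `σ`. Therefore the summand of the character formula depends only on the coset `Hσ`, and the
character is its sum over the representatives `rⱼ⁻¹` and `rⱼ⁻¹ς⁻¹` of `H \ Γ`.
-/

namespace RealTwoRep

variable {k : Type*} [Field k] {Γ : Type*} [Group Γ] {π : Γ →* ℤˣ}

/-! ### The slant product of a twisted cocycle -/

lemma commute_of_semiconjBy {σ g₁ g₀ ω₁ ω₀ : Γ} (eg : g₁ * σ = σ * g₀) (eω : ω₁ * σ = σ * ω₀)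
    (e : g₀ * ω₀ = ω₀ * g₀) : g₁ * ω₁ = ω₁ * g₁ := by
  rw [eq_mul_inv_of_mul_eq eg, eq_mul_inv_of_mul_eq eω]
  exact (Commute.conj_iff σ).2 e

namespace TwistedCocycle

variable (α : TwistedCocycle k π)

/-- The slant product of `α` along a composable pair `ω₁ : g₀ ⟶ g₁`, `ω₂ : g₁ ⟶ g₂` of morphisms
of the conjugation groupoid, so that `g₁ω₁ = ω₁g₀` and `g₂ω₂ = ω₂g₁`. It transgresses `α` to a
twisted 2-cocycle. -/
def slant (ω₂ ω₁ g₂ g₁ g₀ : Γ) : kˣ := α ω₂ ω₁ g₀ * α g₂ ω₂ ω₁ / α ω₂ g₁ ω₁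

/-- The slant product of `slant α` along the morphism `σ : (g₀, ω₀) ⟶ (g₁, ω₁)` of commuting pairs,
so that `g₁σ = σg₀` and `ω₁σ = σω₀`. -/
def slant₂ (σ g₁ g₀ ω₁ ω₀ : Γ) : kˣ := α.slant ω₁ σ g₁ g₁ g₀ / α.slant σ ω₀ g₁ g₀ g₀

lemma slant_cocycle {ω₃ ω₂ ω₁ g₃ g₂ g₁ g₀ : Γ} (hg₃ : π g₃ = 1) (e₁ : g₁ * ω₁ = ω₁ * g₀)
    (e₂ : g₂ * ω₂ = ω₂ * g₁) (e₃ : g₃ * ω₃ = ω₃ * g₂) :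
    α.slant ω₂ ω₁ g₂ g₁ g₀ ^ ((π ω₃ : ℤˣ) : ℤ) * α.slant ω₃ (ω₂ * ω₁) g₃ g₂ g₀ =
      α.slant (ω₃ * ω₂) ω₁ g₃ g₁ g₀ * α.slant ω₃ ω₂ g₃ g₂ g₁ := by
  have h₁ := congrArg Additive.ofMul (α.cocycle g₃ ω₃ ω₂ ω₁)
  have h₂ := congrArg Additive.ofMul (α.cocycle ω₃ g₂ ω₂ ω₁)
  have h₃ := congrArg Additive.ofMul (α.cocycle ω₃ ω₂ g₁ ω₁)
  have h₄ := congrArg Additive.ofMul (α.cocycle ω₃ ω₂ ω₁ g₀)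
  rw [hg₃, e₃] at h₁
  rw [e₂] at h₂
  rw [e₁] at h₃
  apply Additive.ofMul.injective
  simp only [slant, ofMul_mul, ofMul_div, ofMul_zpow, Units.val_one, one_zsmul] at *
  linear_combination (norm := module) h₁ - h₂ + h₃ - h₄

@[simp] lemma slant_one_left (ω g₂ g₁ g₀ : Γ) : α.slant 1 ω g₂ g₁ g₀ = 1 := by simp [slant]

@[simp] lemma slant_one_mid (ω g₂ g₁ g₀ : Γ) : α.slant ω 1 g₂ g₁ g₀ = 1 := by simp [slant]

lemma slant_inv_comm {g ω : Γ} (hg : π g = 1) (hω : π ω = 1) (e : g * ω = ω * g) :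
    α.slant g g⁻¹ ω ω ω = α.slant g⁻¹ g ω ω ω := by
  have e' : ω * g⁻¹ = g⁻¹ * ω := ((show Commute g ω from e).inv_left).eq.symm
  have h := α.slant_cocycle (ω₃ := g) (ω₂ := g⁻¹) (ω₁ := g) hω e.symm e' e.symm
  simpa [hg] using h.symm

lemma slant₂_swap (σ g₁ g₀ ω₁ ω₀ : Γ) :
    α.slant₂ σ ω₁ ω₀ g₁ g₀ = (α.slant₂ σ g₁ g₀ ω₁ ω₀)⁻¹ := by
  apply Additive.ofMul.injective
  simp only [slant₂, slant, ofMul_mul, ofMul_div, ofMul_inv]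
  abel

lemma coeff_div_coeff_swap (σ g₁ g₀ ω₁ ω₀ : Γ) :
    α.coeff ω₁ g₁ σ σ σ ω₀ g₀ / α.coeff g₁ ω₁ σ σ σ g₀ ω₀ = α.slant₂ σ g₁ g₀ ω₁ ω₀ := by
  apply Additive.ofMul.injective
  simp only [coeff, slant₂, slant, ofMul_mul, ofMul_div]
  abel

@[simp] lemma slant₂_one (g ω : Γ) : α.slant₂ 1 g g ω ω = 1 := by simp [slant₂]

@[simp] lemma slant₂_one_mid (σ ω₁ ω₀ : Γ) : α.slant₂ σ 1 1 ω₁ ω₀ = 1 := by simp [slant₂, slant]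

/-- A twisted 2-cocycle transgresses along loops to a twisted homomorphism: combine its cocycle
identities on `(ω₂, σ', σ)`, `(σ', ω₁, σ)` and `(σ', σ, ω₀)`. -/
lemma slant₂_mul {σ' σ g₂ g₁ g₀ ω₂ ω₁ ω₀ : Γ} (hg₂ : π g₂ = 1) (hω₂ : π ω₂ = 1)
    (eg : g₁ * σ = σ * g₀) (eω : ω₁ * σ = σ * ω₀) (eg' : g₂ * σ' = σ' * g₁)
    (eω' : ω₂ * σ' = σ' * ω₁) (e : g₀ * ω₀ = ω₀ * g₀) :
    α.slant₂ (σ' * σ) g₂ g₀ ω₂ ω₀ =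
      α.slant₂ σ' g₂ g₁ ω₂ ω₁ * α.slant₂ σ g₁ g₀ ω₁ ω₀ ^ ((π σ' : ℤˣ) : ℤ) := by
  have e₁ := commute_of_semiconjBy eg eω e
  have e₂ := commute_of_semiconjBy eg' eω' e₁
  have h₁ := congrArg Additive.ofMul (α.slant_cocycle hg₂ eg eg' e₂)
  have h₂ := congrArg Additive.ofMul (α.slant_cocycle hg₂ eg e₁ eg')
  have h₃ := congrArg Additive.ofMul (α.slant_cocycle hg₂ e eg eg')
  rw [eω'] at h₁
  rw [eω] at h₂
  apply Additive.ofMul.injective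
  simp only [slant₂, ofMul_mul, ofMul_div, ofMul_zpow, hω₂, Units.val_one, one_zsmul] at *
  linear_combination (norm := module) h₁ - h₂ + h₃

lemma slant₂_inv {σ g₁ g₀ ω₁ ω₀ : Γ} (hg₀ : π g₀ = 1) (hω₀ : π ω₀ = 1) (eg : g₁ * σ = σ * g₀)
    (eω : ω₁ * σ = σ * ω₀) (e : g₀ * ω₀ = ω₀ * g₀) :
    α.slant₂ σ⁻¹ g₀ g₁ ω₀ ω₁ = (α.slant₂ σ g₁ g₀ ω₁ ω₀ ^ ((π σ : ℤˣ) : ℤ))⁻¹ := by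
  have eg' := (SemiconjBy.inv_symm_left eg.symm).symm
  have eω' := (SemiconjBy.inv_symm_left eω.symm).symm
  have h := α.slant₂_mul hg₀ hω₀ eg eω eg' eω' e
  rw [inv_mul_cancel, slant₂_one, map_inv, Int.units_inv_eq_self] at h
  exact eq_inv_of_mul_eq_one_left h.symm

/-- In the loop variable `slant₂` is multiplicative only up to the 2-cocycle `slant`: combine the
cocycle identities on `(g₁', g₁, σ)`, `(g₁', σ, g₀)` and `(σ, g₀', g₀)`. -/
lemma slant₂_mul_mid {σ g₁' g₁ g₀' g₀ ω₁ ω₀ : Γ} (hg₁' : π g₁' = 1) (hω₁ : π ω₁ = 1)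
    (eg : g₁ * σ = σ * g₀) (eg' : g₁' * σ = σ * g₀') (eω : ω₁ * σ = σ * ω₀)
    (e : g₀ * ω₀ = ω₀ * g₀) (e' : g₀' * ω₀ = ω₀ * g₀') :
    α.slant₂ σ (g₁' * g₁) (g₀' * g₀) ω₁ ω₀ * α.slant g₀' g₀ ω₀ ω₀ ω₀ ^ ((π σ : ℤˣ) : ℤ) =
      α.slant₂ σ g₁' g₀' ω₁ ω₀ * α.slant₂ σ g₁ g₀ ω₁ ω₀ * α.slant g₁' g₁ ω₁ ω₁ ω₁ := by
  have e₁ := (commute_of_semiconjBy eg eω e).symm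
  have e₁' := (commute_of_semiconjBy eg' eω e').symm
  have h₁ := congrArg Additive.ofMul (α.slant_cocycle hω₁ eω e₁ e₁')
  have h₂ := congrArg Additive.ofMul (α.slant_cocycle hω₁ e.symm eω e₁')
  have h₃ := congrArg Additive.ofMul (α.slant_cocycle hω₁ e.symm e'.symm eω)
  rw [eg] at h₁
  rw [eg'] at h₂
  rw [α.slant₂_swap σ ω₁ ω₀ (g₁' * g₁), α.slant₂_swap σ ω₁ ω₀ g₁', α.slant₂_swap σ ω₁ ω₀ g₁]
  apply Additive.ofMul.injective
  simp only [slant₂, ofMul_mul, ofMul_div, ofMul_inv, ofMul_zpow, hg₁', Units.val_one,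
    one_zsmul] at *
  linear_combination (norm := module) h₁ - h₂ + h₃

lemma transgress₂_of_even {σ g g' ω ω' : Γ} (hσ : π σ = 1) (hω : π ω = 1)
    (eg : g' * σ = σ * g) (eω : ω' * σ = σ * ω) (e : g * ω = ω * g) :
    α.transgress₂ σ g ω = α.slant₂ σ g' g ω' ω := by
  rw [eq_mul_inv_of_mul_eq eg, eq_mul_inv_of_mul_eq eω]
  have e₁ : ω * g * ω⁻¹ = g := by rw [← e, mul_inv_cancel_right]
  have e₂ : σ * ω * g * (ω⁻¹ * σ⁻¹) = σ * g * σ⁻¹ := by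
    rw [← mul_assoc, mul_assoc σ, mul_assoc σ, e₁]
  simp [transgress₂, transgress, slant₂, slant, realConj, hσ, hω, e₁, e₂]

lemma transgress₂_of_odd {σ g g' ω ω' : Γ} (hσ : π σ = -1) (hω : π ω = 1)
    (eg : g' * σ = σ * g⁻¹) (eω : ω' * σ = σ * ω) (e : g * ω = ω * g) :
    α.transgress₂ σ g ω = α.slant₂ σ g' g⁻¹ ω' ω * α.slant g⁻¹ g ω ω ω := by
  rw [eq_mul_inv_of_mul_eq eg, eq_mul_inv_of_mul_eq eω]
  have e₁ : ω * g * ω⁻¹ = g := by rw [← e, mul_inv_cancel_right]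
  have e₂ : ω * g⁻¹ * ω⁻¹ = g⁻¹ := by rw [← conj_inv, e₁]
  have e₃ : σ * ω * g⁻¹ * (ω⁻¹ * σ⁻¹) = σ * g⁻¹ * σ⁻¹ := by
    rw [← mul_assoc, mul_assoc σ, mul_assoc σ, e₂]
  simp only [transgress₂, transgress, map_mul, hσ, hω, mul_one, map_inv, inv_neg, inv_one, mul_neg,
    neg_neg, units_ne_neg_self, and_true, ↓reduceIte, realConj, Units.val_neg, Units.val_one,
    Int.reduceNeg, zpow_neg, zpow_ofNat, pow_one, inv_inv, sub_self, EuclideanDomain.zero_div,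
    pow_zero, inv_mul_cancel_right, mul_inv_rev, e₃, one_mul, and_false, e₂, e₁, Int.reduceSub,
    ne_eq, OfNat.ofNat_ne_zero, not_false_eq_true, Int.neg_ediv_self, inv_div, slant₂, slant]
  rw [div_mul_eq_div_div_swap, div_div_eq_mul_div, mul_div_assoc]

lemma transgress₂_mul {x σ g₂ g₁ g ω₂ ω₁ ω : Γ} (hx : π x = 1) (hg : π g = 1) (hω : π ω = 1)
    (eg : g₁ * σ = σ * g ^ ((π σ : ℤˣ) : ℤ)) (eω : ω₁ * σ = σ * ω) (eg' : g₂ * x = x * g₁)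
    (eω' : ω₂ * x = x * ω₁) (e : g * ω = ω * g) :
    α.transgress₂ (x * σ) g ω = α.slant₂ x g₂ g₁ ω₂ ω₁ * α.transgress₂ σ g ω := by
  have π_eq : ∀ {s a b : Γ}, a * s = s * b → π a = π b := fun h => by
    simpa [mul_comm] using congrArg π h
  have hω₂ : π ω₂ = 1 := (π_eq eω').trans ((π_eq eω).trans hω)
  have hg₂ : π g₂ = 1 := (π_eq eg').trans ((π_eq eg).trans (by rw [map_zpow, hg, one_zpow]))
  have eω'' : ω₂ * (x * σ) = x * σ * ω := (SemiconjBy.mul_left eω'.symm eω.symm).symm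
  have eg'' : g₂ * (x * σ) = x * σ * g ^ ((π σ : ℤˣ) : ℤ) :=
    (SemiconjBy.mul_left eg'.symm eg.symm).symm
  rcases Int.units_eq_one_or (π σ) with hσ | hσ <;>
    simp only [hσ, Units.val_one, Units.val_neg, zpow_one, zpow_neg] at eg eg''
  · rw [α.transgress₂_of_even (by simp [hx, hσ]) hω eg'' eω'' e,
      α.transgress₂_of_even hσ hω eg eω e, α.slant₂_mul hg₂ hω₂ eg eω eg' eω' e]
    simp [hx]
  · have e' : g⁻¹ * ω = ω * g⁻¹ := (show Commute g ω from e).inv_left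
    rw [α.transgress₂_of_odd (by simp [hx, hσ]) hω eg'' eω'' e,
      α.transgress₂_of_odd hσ hω eg eω e, α.slant₂_mul hg₂ hω₂ eg eω eg' eω' e']
    simp [hx, mul_assoc]

lemma inv_transgress₂_inv_of_even {σ g₁ g₀ ω₁ ω₀ : Γ} (hσ : π σ = 1) (hg : π g₀ = 1)
    (hω : π ω₀ = 1) (eg : g₁ * σ = σ * g₀) (eω : ω₁ * σ = σ * ω₀) (e : g₁ * ω₁ = ω₁ * g₁) :
    (α.transgress₂ σ⁻¹ g₁ ω₁)⁻¹ = α.slant₂ σ g₁ g₀ ω₁ ω₀ := by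
  have eg' := (SemiconjBy.inv_symm_left eg.symm).symm
  have eω' := (SemiconjBy.inv_symm_left eω.symm).symm
  have hω₁ : π ω₁ = 1 := by simpa [hω, mul_comm] using congrArg π eω
  rw [α.transgress₂_of_even (by simp [hσ]) hω₁ eg' eω' e,
    α.slant₂_inv hg hω eg eω (commute_of_semiconjBy eg' eω' e)]
  simp [hσ]

lemma inv_transgress₂_inv_of_odd {σ g a b ω₁ ω₀ : Γ} (hσ : π σ = -1) (hg : π g = 1)
    (hω : π ω₀ = 1) (eg : g * σ = σ * a) (eω : ω₁ * σ = σ * ω₀) (hab : a * b = 1)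
    (e : g * ω₁ = ω₁ * g) :
    (α.transgress₂ σ⁻¹ g ω₁)⁻¹ = α.slant₂ σ g a ω₁ ω₀ * α.slant a b ω₀ ω₀ ω₀ := by
  obtain rfl : b = a⁻¹ := (inv_eq_of_mul_eq_one_right hab).symm
  have hω₁ : π ω₁ = 1 := by simpa [hω, mul_comm] using congrArg π eω
  have ha : π a = 1 := by simpa [hg, mul_comm, eq_comm] using congrArg π eg
  have eg' := (SemiconjBy.inv_symm_left eg.symm).symm
  have eω' := (SemiconjBy.inv_symm_left eω.symm).symm
  have e₀ := commute_of_semiconjBy eg' eω' e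
  have eb : g⁻¹ * σ = σ * a⁻¹ := (SemiconjBy.inv_right eg.symm).symm
  have eb' : a⁻¹ * σ⁻¹ = σ⁻¹ * g⁻¹ := (SemiconjBy.inv_symm_left eb.symm).symm
  have e₀' : a⁻¹ * ω₀ = ω₀ * a⁻¹ := (show Commute a ω₀ from e₀).inv_left
  have h := α.slant₂_mul_mid (σ := σ) hg hω₁ eb eg eω e₀' e₀
  rw [mul_inv_cancel, mul_inv_cancel, slant₂_one_mid, hσ, α.slant_inv_comm hg hω₁ e] at h
  rw [α.transgress₂_of_odd (by simp [hσ]) hω₁ eb' eω' e,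
    α.slant₂_inv (by simp [ha]) hω eb eω e₀', hσ]
  simp only [Units.val_neg, Units.val_one, zpow_neg, zpow_one, inv_inv, one_mul] at h ⊢
  rw [← inv_inv (α.slant a a⁻¹ _ _ _), h]
  simp only [mul_assoc, mul_inv, mul_inv_cancel_left]

@[simp] lemma slant_res {H : Subgroup Γ} (hH : H ≤ π.ker) (ω₂ ω₁ g₂ g₁ g₀ : H) :
    (α.res hH).slant ω₂ ω₁ g₂ g₁ g₀ = α.slant ω₂ ω₁ g₂ g₁ g₀ := rfl

end TwistedCocycle

/-! ### Conjugation and mates for ungraded representations -/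

namespace TwistedRep

variable {α : TwistedCocycle k (1 : Γ →* ℤˣ)}
  {V : Type u} [Category.{v} V] [Preadditive V] [Linear k V] (ρ : TwistedRep 1 α V)

lemma mulIso_hom_comp_mulIso_hom {g₃ g₂ g₁ g₃₂ g₂₁ g : Γ} (m₃₂ : g₃ * g₂ = g₃₂)
    (m₂₁ : g₂ * g₁ = g₂₁) (m : g₃₂ * g₁ = g) (m' : g₃ * g₂₁ = g) (x : V) :
    (ρ.mulIso m₃₂ ((ρ.fn g₁).obj x)).hom ≫ (ρ.mulIso m x).hom =
      (((α g₃ g₂ g₁)⁻¹ : kˣ) : k) •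
        ((ρ.fn g₃).map (ρ.mulIso m₂₁ x).hom ≫ (ρ.mulIso m' x).hom) := by
  rw [← ρ.mulIso_assoc m₃₂ m₂₁ m m' x, smul_smul, Units.inv_mul, one_smul]

lemma mulIso_one_mul_hom {g : Γ} (m : 1 * g = g) (x : V) :
    (ρ.mulIso m x).hom = ρ.oneIso.hom.app ((ρ.fn g).obj x) :=
  congrArg Iso.hom (ρ.oneIso_left g x)

lemma mulIso_mul_one_hom {g : Γ} (m : g * 1 = g) (x : V) :
    (ρ.mulIso m x).hom = (ρ.fn g).map (ρ.oneIso.hom.app x) :=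
  congrArg Iso.hom (ρ.oneIso_right g x)

/-- The isomorphism `ρ(a)(ρ(b) x) ≅ x`, for `ab = 1`. -/
def cancelIso {a b : Γ} (m : a * b = 1) (x : V) : (ρ.fn a).obj ((ρ.fn b).obj x) ≅ x :=
  ρ.mulIso m x ≪≫ ρ.oneIso.app x

lemma cancelIso_hom_naturality {a b : Γ} (m : a * b = 1) {x y : V} (f : x ⟶ y) :
    (ρ.fn a).map ((ρ.fn b).map f) ≫ (ρ.cancelIso m y).hom = (ρ.cancelIso m x).hom ≫ f :=
  square_comp (ρ.mulIso_nat m f) (ρ.oneIso.hom.naturality f)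

lemma cancelIso_hom_fn_obj {a b : Γ} (m : a * b = 1) (m' : b * a = 1) (x : V) :
    (ρ.cancelIso m ((ρ.fn a).obj x)).hom =
      (((α a b a)⁻¹ : kˣ) : k) • (ρ.fn a).map (ρ.cancelIso m' x).hom := by
  have h := ρ.mulIso_hom_comp_mulIso_hom m m' (one_mul a) (mul_one a) x
  rw [mulIso_one_mul_hom, mulIso_mul_one_hom, ← Functor.map_comp] at h
  exact h

instance fn_faithful (g : Γ) : (ρ.fn g).Faithful where
  map_injective {x _ f f'} h := by
    rw [← cancel_epi (ρ.cancelIso (inv_mul_cancel g) x).hom, ← cancelIso_hom_naturality,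
      ← cancelIso_hom_naturality, h]

lemma natTrans_ext_of_app_fn_obj (ω : Γ) {F : V ⥤ V} {φ φ' : 𝟭 V ⟶ F}
    (h : ∀ y, φ.app ((ρ.fn ω).obj y) = φ'.app ((ρ.fn ω).obj y)) : φ = φ' := by
  ext x
  let e := ρ.cancelIso (mul_inv_cancel ω) x
  have h₁ := φ.naturality e.hom
  have h₂ := φ'.naturality e.hom
  rw [h, ← h₂] at h₁
  exact (cancel_epi e.hom).1 h₁

/-- The map `β_{g,ω} : Hom(1_V, ρ(g)) ⟶ Hom(1_V, ρ(g'))` of an ungraded representation, for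
`g' = ωgω⁻¹`. -/
def conj {g ω g' : Γ} (m : g' * ω = ω * g) : (𝟭 V ⟶ ρ.fn g) →ₗ[k] (𝟭 V ⟶ ρ.fn g') :=
  ρ.betaEven rfl rfl rfl m

/-- Evaluating at `ρ(ω) y` removes the conjugating isomorphisms `ρ(ω)ρ(ω⁻¹) ≅ 1` from the
definition of `β_{g,ω}`. -/
lemma conj_app_fn_obj {g ω g' n : Γ} (m : g' * ω = n) (m' : ω * g = n) (φ : 𝟭 V ⟶ ρ.fn g) (y : V) :
    (ρ.conj (m.trans m'.symm) φ).app ((ρ.fn ω).obj y) ≫ (ρ.mulIso m y).hom =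
      (ρ.fn ω).map (φ.app y) ≫ (ρ.mulIso m' y).hom := by
  subst m'
  let e := ρ.cancelIso (mul_inv_cancel ω) ((ρ.fn ω).obj y)
  let x := (ρ.fn ω⁻¹).obj ((ρ.fn ω).obj y)
  change (e.inv ≫ (ρ.fn ω).map (φ.app x) ≫ (ρ.mulIso rfl x).hom ≫ (ρ.mulIso m x).inv ≫
    (ρ.fn g').map e.hom) ≫ _ = _
  have he : e.hom = _ := ρ.cancelIso_hom_fn_obj (mul_inv_cancel ω) (inv_mul_cancel ω) y
  have h := φ.naturality (ρ.cancelIso (inv_mul_cancel ω) y).hom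
  simp only [Functor.id_map] at h
  simp only [Category.assoc]
  rw [Iso.inv_comp_eq, he, Functor.map_smul, Linear.smul_comp, Linear.smul_comp, Linear.comp_smul,
    Linear.comp_smul, Linear.comp_smul, ρ.mulIso_nat m, ← Functor.map_comp_assoc, h,
    Functor.map_comp_assoc, ρ.mulIso_nat rfl, Iso.inv_hom_id_assoc]

lemma conj_eq_of_app_fn_obj {g ω g' n : Γ} (m : g' * ω = n) (m' : ω * g = n) {φ : 𝟭 V ⟶ ρ.fn g}
    {φ' : 𝟭 V ⟶ ρ.fn g'}
    (h : ∀ y, φ'.app ((ρ.fn ω).obj y) ≫ (ρ.mulIso m y).hom =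
      (ρ.fn ω).map (φ.app y) ≫ (ρ.mulIso m' y).hom) :
    ρ.conj (m.trans m'.symm) φ = φ' := by
  refine ρ.natTrans_ext_of_app_fn_obj ω fun y => ?_
  rw [← cancel_mono (ρ.mulIso m y).hom, h, ρ.conj_app_fn_obj m m']

lemma conj_one {g : Γ} (m : g * 1 = 1 * g) (φ : 𝟭 V ⟶ ρ.fn g) : ρ.conj m φ = φ := by
  refine ρ.conj_eq_of_app_fn_obj (mul_one g) (one_mul g) fun y => ?_
  rw [mulIso_one_mul_hom, mulIso_mul_one_hom]
  exact ((ρ.oneIso.hom.naturality (φ.app y)).trans (φ.naturality (ρ.oneIso.hom.app y))).symm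

lemma conj_conj_app {g₀ g₁ g₂ ω₁ ω₂ ω : Γ} (m₁ : g₁ * ω₁ = ω₁ * g₀) (m₂ : g₂ * ω₂ = ω₂ * g₁)
    (mω : ω₂ * ω₁ = ω) (m : g₂ * ω = ω * g₀) (φ : 𝟭 V ⟶ ρ.fn g₀) (y : V) :
    (ρ.mulIso mω y).hom ≫ (ρ.conj m₂ (ρ.conj m₁ φ)).app ((ρ.fn ω).obj y) ≫ (ρ.mulIso m y).hom =
      (α.slant ω₂ ω₁ g₂ g₁ g₀ : k) •
        ((ρ.mulIso mω y).hom ≫ (ρ.fn ω).map (φ.app y) ≫ (ρ.mulIso rfl y).hom) := by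
  obtain ⟨φ₁, h₁⟩ : ∃ φ₁, φ₁ = ρ.conj m₁ φ := ⟨_, rfl⟩
  obtain ⟨φ₂, h₂⟩ : ∃ φ₂, φ₂ = ρ.conj m₂ φ₁ := ⟨_, rfl⟩
  have s₁ := congrArg (ρ.fn ω₂).map (ρ.conj_app_fn_obj m₁ rfl φ y)
  have s₂ := ρ.conj_app_fn_obj m₂ rfl φ₁ ((ρ.fn ω₁).obj y)
  simp only [← h₁, ← h₂, Functor.map_comp] at s₁ s₂ ⊢
  have q : ω₂ * g₁ * ω₁ = ω * g₀ := by rw [mul_assoc, m₁, ← mul_assoc, mω]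
  have q' : ω₂ * (ω₁ * g₀) = ω * g₀ := by rw [← mul_assoc, mω]
  have a₁ := ρ.mulIso_assoc m₂ mω q m y
  have a₂ := ρ.mulIso_hom_comp_mulIso_hom (rfl : ω₂ * g₁ = _) m₁ q q' y
  have a₃ := ρ.mulIso_assoc mω (rfl : ω₁ * g₀ = _) rfl q' y
  have n₂ := φ₂.naturality (ρ.mulIso mω y).hom
  simp only [Functor.id_map] at n₂
  rw [← reassoc_of% (ρ.mulIso_nat mω (φ.app y)), reassoc_of% n₂, ← a₁, Linear.comp_smul,
    reassoc_of% s₂, a₂, Linear.comp_smul, reassoc_of% s₁, ← a₃]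
  simp only [Linear.comp_smul, smul_smul, ← Units.val_mul]
  congr 2
  rw [TwistedCocycle.slant, mul_left_comm, inv_mul_eq_div, mul_comm (α g₂ ω₂ ω₁)]

lemma conj_conj {g₀ g₁ g₂ ω₁ ω₂ ω : Γ} (m₁ : g₁ * ω₁ = ω₁ * g₀) (m₂ : g₂ * ω₂ = ω₂ * g₁)
    (mω : ω₂ * ω₁ = ω) (m : g₂ * ω = ω * g₀) (φ : 𝟭 V ⟶ ρ.fn g₀) :
    ρ.conj m₂ (ρ.conj m₁ φ) = (α.slant ω₂ ω₁ g₂ g₁ g₀ : k) • ρ.conj m φ := by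
  refine ρ.natTrans_ext_of_app_fn_obj ω fun y => ?_
  rw [← cancel_mono (ρ.mulIso m y).hom, ← cancel_epi (ρ.mulIso mω y).hom,
    ρ.conj_conj_app m₁ m₂ mω m, NatTrans.app_smul, Linear.smul_comp, ρ.conj_app_fn_obj m rfl,
    Linear.comp_smul]

lemma conj_bijective {g ω g' : Γ} (m : g' * ω = ω * g) : Function.Bijective (ρ.conj m) := by
  have m' : g * ω⁻¹ = ω⁻¹ * g' := (SemiconjBy.inv_symm_left m.symm).symm
  constructor
  · refine (injective_iff_map_eq_zero _).2 fun φ h => ?_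
    have h' := ρ.conj_conj m m' (inv_mul_cancel ω) (by simp) φ
    rw [h, map_zero, conj_one] at h'
    exact (smul_eq_zero.1 h'.symm).resolve_left (Units.ne_zero _)
  · intro φ
    have h' := ρ.conj_conj m' m (mul_inv_cancel ω) (by simp) φ
    rw [conj_one] at h'
    refine ⟨(((α.slant ω ω⁻¹ g' g g')⁻¹ : kˣ) : k) • ρ.conj m' φ, ?_⟩
    rw [map_smul, h', smul_smul, Units.inv_mul, one_smul]

lemma char_eq_trace_conj {g ω : Γ} (m : g * ω = ω * g) :
    ρ.char g ω = LinearMap.trace k (𝟭 V ⟶ ρ.fn g) (ρ.conj m) := by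
  rw [char, dif_pos ⟨rfl, rfl, m⟩]
  rfl

lemma char_conj {g₀ ω₀ g₁ ω₁ σ : Γ} (m : g₀ * ω₀ = ω₀ * g₀) (mg : g₁ * σ = σ * g₀)
    (mω : ω₁ * σ = σ * ω₀) :
    ρ.char g₁ ω₁ = (α.slant₂ σ g₁ g₀ ω₁ ω₀ : k) * ρ.char g₀ ω₀ := by
  have m₁ : g₁ * ω₁ = ω₁ * g₁ := commute_of_semiconjBy mg mω m
  have q : g₁ * (σ * ω₀) = σ * ω₀ * g₀ := (SemiconjBy.mul_left mg.symm m.symm).symm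
  let E := LinearEquiv.ofBijective (ρ.conj mg) (ρ.conj_bijective mg)
  have hE : (α.slant₂ σ g₁ g₀ ω₁ ω₀ : k) • E.conj (ρ.conj m) = ρ.conj m₁ := by
    ext1 φ
    obtain ⟨φ, rfl⟩ := E.surjective φ
    rw [LinearMap.smul_apply, LinearEquiv.conj_apply_apply, LinearEquiv.symm_apply_apply,
      LinearEquiv.ofBijective_apply, LinearEquiv.ofBijective_apply,
      ρ.conj_conj m mg rfl q, ρ.conj_conj mg m₁ mω q, smul_smul, ← Units.val_mul,
      TwistedCocycle.slant₂, div_mul_cancel]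
  rw [ρ.char_eq_trace_conj m, ρ.char_eq_trace_conj m₁, ← LinearMap.trace_conj' _ E, ← hE,
    map_smul, smul_eq_mul]

/-- For `ab = 1`, the transformation `ρ(a) ⟹ ρ(a) ρ(b) ⟹ 1_V` obtained from `1_V ⟹ ρ(b)`. -/
def mateMap {a b : Γ} (m : a * b = 1) : (𝟭 V ⟶ ρ.fn b) →ₗ[k] (ρ.fn a ⟶ 𝟭 V) where
  toFun φ :=
    { app := fun x => (ρ.fn a).map (φ.app x) ≫ (ρ.cancelIso m x).hom
      naturality := fun _ _ f =>
        square_comp (square_map _ (φ.naturality f)) (ρ.cancelIso_hom_naturality m f) }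
  map_add' φ φ' := by
    ext x
    exact (congrArg (· ≫ _) ((ρ.fn a).map_add)).trans (Preadditive.add_comp _ _ _ _ _ _)
  map_smul' c φ := by
    ext x
    exact (congrArg (· ≫ _) ((ρ.fn a).map_smul _ _)).trans (Linear.smul_comp _ _ _ _ _ _)

lemma mateMap_app {a b : Γ} (m : a * b = 1) (φ : 𝟭 V ⟶ ρ.fn b) (x : V) :
    (ρ.mateMap m φ).app x = (ρ.fn a).map (φ.app x) ≫ (ρ.cancelIso m x).hom := rfl

lemma mateMap_injective {a b : Γ} (m : a * b = 1) : Function.Injective (ρ.mateMap m) := by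
  intro φ φ' h
  ext x
  apply (ρ.fn a).map_injective
  rw [← cancel_mono (ρ.cancelIso m x).hom, ← mateMap_app, ← mateMap_app, h]

lemma mateMap_surjective {a b : Γ} (m : a * b = 1) : Function.Surjective (ρ.mateMap m) := by
  intro θ
  have m' : b * a = 1 := mul_eq_one_comm.1 m
  let φ : 𝟭 V ⟶ ρ.fn b :=
    { app := fun x => (ρ.cancelIso m' x).inv ≫ (ρ.fn b).map (θ.app x)
      naturality := fun _ _ f =>
        square_comp (square_inv (ρ.cancelIso_hom_naturality m' f))
          (square_map _ (θ.naturality f)) }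
  refine ⟨(α a b a : k) • φ, ?_⟩
  ext x
  have h := ρ.cancelIso_hom_naturality m (θ.app x)
  simp only [Functor.id_obj] at h
  rw [map_smul, NatTrans.app_smul, mateMap_app, Functor.map_comp, Category.assoc, h,
    ρ.cancelIso_hom_fn_obj m m', Linear.smul_comp, Linear.comp_smul, smul_smul, Units.mul_inv,
    one_smul, Iso.map_inv_hom_id_assoc]

/-- The linear equivalence `Hom(1_V, ρ(b)) ≃ Hom(ρ(a), 1_V)`, for `ab = 1`. -/
noncomputable def mateEquiv {a b : Γ} (m : a * b = 1) : (𝟭 V ⟶ ρ.fn b) ≃ₗ[k] (ρ.fn a ⟶ 𝟭 V) :=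
  LinearEquiv.ofBijective (ρ.mateMap m) ⟨ρ.mateMap_injective m, ρ.mateMap_surjective m⟩

lemma mateEquiv_app {a b : Γ} (m : a * b = 1) (φ : 𝟭 V ⟶ ρ.fn b) (x : V) :
    (ρ.mateEquiv m φ).app x = (ρ.fn a).map (φ.app x) ≫ (ρ.cancelIso m x).hom := rfl

lemma mulIso_inv_comp_map_mateEquiv {a b w p : Γ} (m : a * b = 1) (ma : w * a = p) (q : p * b = w)
    (φ : 𝟭 V ⟶ ρ.fn b) (y : V) :
    (ρ.mulIso ma y).inv ≫ (ρ.fn w).map ((ρ.mateEquiv m φ).app y) =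
      (α w a b : k) • ((ρ.fn p).map (φ.app y) ≫ (ρ.mulIso q y).hom) := by
  rw [mateEquiv_app, cancelIso, Iso.trans_hom, Iso.app_hom, Functor.map_comp, Functor.map_comp,
    ← ρ.mulIso_mul_one_hom (mul_one w), ← ρ.mulIso_assoc ma m q (mul_one w) y, Linear.comp_smul,
    Linear.comp_smul, reassoc_of% (ρ.mulIso_inv_nat ma (φ.app y)), Iso.inv_hom_id_assoc]

lemma mulIso_inv_comp_mateEquiv_conj {a b w n p : Γ} (m : a * b = 1) (mb : b * w = n)
    (mb' : w * b = n) (ma : a * w = p) (q : p * b = w) (φ : 𝟭 V ⟶ ρ.fn b) (y : V) :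
    (ρ.mulIso ma y).inv ≫
        (ρ.mateEquiv m (ρ.conj (mb.trans mb'.symm) φ)).app ((ρ.fn w).obj y) =
      ((α a w b / α a b w : kˣ) : k) • ((ρ.fn p).map (φ.app y) ≫ (ρ.mulIso q y).hom) := by
  have qn : a * n = w := by rw [← mb, ← mul_assoc, m, one_mul]
  have s := congrArg (ρ.fn a).map (ρ.conj_app_fn_obj mb mb' φ y)
  simp only [Functor.map_comp] at s
  rw [Iso.inv_comp_eq, mateEquiv_app, cancelIso, Iso.trans_hom, Iso.app_hom,
    ← ρ.mulIso_one_mul_hom (one_mul w), ρ.mulIso_hom_comp_mulIso_hom m mb (one_mul w) qn y,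
    Linear.comp_smul, reassoc_of% s, ← ρ.mulIso_assoc ma mb' q qn y, Linear.comp_smul,
    Linear.comp_smul, smul_smul, ← reassoc_of% (ρ.mulIso_nat ma (φ.app y)), ← Units.val_mul,
    div_eq_inv_mul]

lemma mateEquiv_conj {a b w n p : Γ} (m : a * b = 1) (mb : b * w = n)
    (mb' : w * b = n) (ma : a * w = p) (ma' : w * a = p) (φ : 𝟭 V ⟶ ρ.fn b) (y : V) :
    (ρ.mulIso ma y).inv ≫
        (ρ.mateEquiv m (ρ.conj (mb.trans mb'.symm) φ)).app ((ρ.fn w).obj y) =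
      (((α.slant a b w w w)⁻¹ : kˣ) : k) •
        ((ρ.mulIso ma' y).inv ≫ (ρ.fn w).map ((ρ.mateEquiv m φ).app y)) := by
  have q : p * b = w := by rw [← ma', mul_assoc, m, mul_one]
  rw [ρ.mulIso_inv_comp_mateEquiv_conj m mb mb' ma q, ρ.mulIso_inv_comp_map_mateEquiv m ma' q,
    smul_smul, ← Units.val_mul, TwistedCocycle.slant, inv_div, div_mul_eq_mul_div,
    mul_div_mul_right_eq_div]

end TwistedRep

/-! ### The hyperbolic construction -/

section MapZero

variable {C D : Type*} [Category C] [Category D] [Preadditive C] [Preadditive D] (F : C ⥤ D)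
  [F.Additive] {X Y : C} {f : X ⟶ Y}

lemma map_comp_eq_zero (hf : f = 0) {B : D} (b : F.obj Y ⟶ B) : F.map f ≫ b = 0 := by
  rw [hf, Functor.map_zero, Limits.zero_comp]

lemma comp_map_comp_eq_zero (hf : f = 0) {A B : D} (a : A ⟶ F.obj X) (b : F.obj Y ⟶ B) :
    a ≫ F.map f ≫ b = 0 := by
  rw [map_comp_eq_zero F hf, Limits.comp_zero]

end MapZero

section ProdOp

variable (k) {W : Type u} [Category.{v} W] [Preadditive W] [Linear k W]
  (F F' : W ⥤ W)

/-- Transformations `1 ⟹ F × F'ᵒᵖ` on `W × Wᵒᵖ` are pairs of transformations `1 ⟹ F` and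
`F' ⟹ 1`. Since `W` has zero morphisms, the first component at `(x, y)` does not depend on `y`, nor
the second on `x`. -/
def prodOpEquiv : ((𝟭 W ⟶ F) × (F' ⟶ 𝟭 W)) ≃ₗ[k] (𝟭 (W × Wᵒᵖ) ⟶ F.prod F'.op) where
  toFun φ :=
    { app := fun X => Prod.mkHom (φ.1.app X.1) (φ.2.app X.2.unop).op
      naturality := fun _ _ f => Prod.ext (φ.1.naturality f.1)
        (Quiver.Hom.unop_inj (φ.2.naturality f.2.unop).symm) }
  map_add' _ _ := rfl
  map_smul' _ _ := rfl
  invFun Φ :=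
    ({ app := fun x => (Φ.app (x, op x)).1
       naturality := fun x x' f => congrArg Prod.fst
         (Φ.naturality (Prod.mkHom f 0 : (x, op x) ⟶ (x', op x'))) },
     { app := fun y => (Φ.app (y, op y)).2.unop
       naturality := fun y y' f => congrArg (fun f => f.2.unop)
         (Φ.naturality (Prod.mkHom 0 f.op : (y', op y') ⟶ (y, op y))).symm })
  left_inv _ := rfl
  right_inv Φ := by
    ext X
    · have h := congrArg Prod.fst
        (Φ.naturality (Prod.mkHom (𝟙 X.1) 0 : (X.1, op X.1) ⟶ (X.1, X.2)))
      exact (by simpa using h.symm : (Φ.app (X.1, op X.1)).1 = (Φ.app X).1)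
    · have h := congrArg Prod.snd
        (Φ.naturality (Prod.mkHom 0 (𝟙 X.2) : (X.2.unop, X.2) ⟶ (X.1, X.2)))
      exact (by simpa using h.symm : (Φ.app (X.2.unop, X.2)).2 = (Φ.app X).2)

end ProdOp

lemma trace_eq_zero_of_diagonal_eq_zero {R M N : Type*} [CommRing R] [AddCommGroup M] [Module R M]
    [AddCommGroup N] [Module R N] (f : Module.End R (M × N)) (h₁ : ∀ x, (f (x, 0)).1 = 0)
    (h₂ : ∀ y, (f (0, y)).2 = 0) : LinearMap.trace R (M × N) f = 0 := by
  let p : Module.End R (M × N) := LinearMap.inl R M N ∘ₗ LinearMap.fst R M N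
  let q : Module.End R (M × N) := LinearMap.inr R M N ∘ₗ LinearMap.snd R M N
  have e : f = f * p * p + f * q * q := by
    refine LinearMap.ext fun x => ?_
    simp [p, q, ← map_add]
  have hp : p * (f * p) = 0 := LinearMap.ext fun x => by simp [p, h₁]
  have hq : q * (f * q) = 0 := LinearMap.ext fun x => by simp [q, h₂]
  rw [e, map_add, LinearMap.trace_mul_comm, hp, LinearMap.trace_mul_comm R (f * q), hq, map_zero,
    add_zero]

namespace TwistedRep

variable {ς : Γ} {α : TwistedCocycle k π} {W : Type u} [Category.{v} W] [Preadditive W]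
  [Linear k W]

/-- The restriction of a Real representation to the ungraded group `ker π`. -/
def resKer (ρ : TwistedRep π α W) : TwistedRep (1 : π.ker →* ℤˣ) (α.res le_rfl) W :=
  ofUngraded (fun g => (ρ.act (ε := .even) g.2).cov) (fun g => ρ.linear (ε := .even) g.2)
    (fun {g₂ g₁ g} m x => ρ.ψ (ε₂ := .even) (ε₁ := .even) (ε := .even) g₂.2 g₁.2 g.2
      (congrArg Subtype.val m) x)
    ρ.ψe (fun _ _ _ _ => ρ.nat_even_even _ _ _ _ _)
    (fun _ _ _ _ _ => ρ.assoc (ε₃ := .even) (ε₂ := .even) (ε₁ := .even) (ε₃₂ := .even)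
      (ε₂₁ := .even) (ε := .even) _ _ _ _ _ _ _ _ _ _ _)
    (fun _ _ => ρ.unit_left (ε := .even) _ _) (fun _ _ => ρ.unit_right (ε := .even) _ _)

lemma char_resKer (ρ : TwistedRep π α W) (g ω : π.ker) (m : g * ω = ω * g) :
    ρ.resKer.char g ω = ρ.char g ω := by
  rw [char_eq_trace_conj _ m, char, dif_pos ⟨g.2, ω.2, congrArg Subtype.val m⟩]
  rfl

variable (ρ : TwistedRep (1 : π.ker →* ℤˣ) (α.res le_rfl) W) (hς : π ς = -1)

/-- The decomposition `Tr_{HInd(ρ)}(g) ≃ Tr_ρ(g) × Tr_ρ(b)`, where `b = ς⁻¹ g⁻¹ ς`. -/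
noncomputable def hIndTrEquiv {g b : π.ker} (m : conjElt hς g.2 * b = 1) :
    ((𝟭 W ⟶ ρ.fn g) × (𝟭 W ⟶ ρ.fn b)) ≃ₗ[k] (𝟭 (W × Wᵒᵖ) ⟶ (ρ.hInd hς).resKer.fn g) :=
  (LinearEquiv.refl k _).prodCongr (ρ.mateEquiv m) ≪≫ₗ
    prodOpEquiv k (ρ.fn g) (ρ.fn (conjElt hς g.2))

lemma hIndTrEquiv_conj {g b ω c : π.ker} (m : conjElt hς g.2 * b = 1) (hc : conjElt hς ω.2 = c)
    (e : g * ω = ω * g) (e' : b * c = c * b) (φ : (𝟭 W ⟶ ρ.fn g) × (𝟭 W ⟶ ρ.fn b)) :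
    (ρ.hInd hς).resKer.conj e (ρ.hIndTrEquiv hς m φ) = ρ.hIndTrEquiv hς m
      (ρ.conj e φ.1, ((α.slant₂ ς g (conjElt hς g.2) ω c *
        α.slant (conjElt hς g.2) b c c c : kˣ) : k) • ρ.conj e' φ.2) := by
  subst hc
  have ma' : conjElt hς ω.2 * conjElt hς g.2 = conjElt hς (ω * g).2 :=
    Subtype.ext (by simp [conjElt, mul_assoc])
  have ma : conjElt hς g.2 * conjElt hς ω.2 = conjElt hς (ω * g).2 := by
    simp only [← e]
    exact Subtype.ext (by simp [conjElt, mul_assoc])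
  rw [← α.coeff_div_coeff_swap]
  generalize hs : (_ * _ : kˣ) = s
  refine (ρ.hInd hς).resKer.conj_eq_of_app_fn_obj e rfl fun Y => ?_
  refine Prod.ext ?_ (Quiver.Hom.unop_inj ?_)
  · change (ρ.conj e φ.1).app ((ρ.fn ω).obj Y.1) ≫ (scaleIso (1 : kˣ) (ρ.mulIso e Y.1)).hom =
      (ρ.fn ω).map (φ.1.app Y.1) ≫ (scaleIso (1 : kˣ) (ρ.mulIso rfl Y.1)).hom
    simpa using ρ.conj_app_fn_obj e rfl φ.1 Y.1
  · have h := ρ.mateEquiv_conj m e' rfl ma ma' φ.2 Y.2.unop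
    change (scaleIso (α.coeff g ω ς ς ς (conjElt hς g.2) (conjElt hς ω.2))⁻¹
        (ρ.mulIso ma Y.2.unop)).inv ≫ (ρ.mateEquiv m ((s : k) • ρ.conj e' φ.2)).app _ =
      (scaleIso (α.coeff ω g ς ς ς (conjElt hς ω.2) (conjElt hς g.2))⁻¹
        (ρ.mulIso ma' Y.2.unop)).inv ≫
          (ρ.fn (conjElt hς ω.2)).map ((ρ.mateEquiv m φ.2).app Y.2.unop)
    rw [map_smul, NatTrans.app_smul]
    simp only [scaleIso_inv, inv_inv, Linear.smul_comp, Linear.comp_smul, Functor.id_obj] at h ⊢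
    rw [h, smul_smul, smul_smul, ← Units.val_mul, ← Units.val_mul, ← hs,
      TwistedCocycle.slant_res, mul_right_comm, mul_inv_cancel_right, div_mul_cancel]

lemma char_hInd_of_even [∀ g, Module.Finite k (𝟭 W ⟶ ρ.fn g)] {g b ω c : π.ker}
    (m : conjElt hς g.2 * b = 1) (hc : conjElt hς ω.2 = c) (e : g * ω = ω * g)
    (e' : b * c = c * b) :
    (ρ.hInd hς).char g ω = ρ.char g ω +
      ((α.slant₂ ς g (conjElt hς g.2) ω c * α.slant (conjElt hς g.2) b c c c : kˣ) : k) *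
        ρ.char b c := by
  rw [← char_resKer _ g ω e, char_eq_trace_conj _ e, char_eq_trace_conj _ e,
    char_eq_trace_conj _ e', ← smul_eq_mul, ← map_smul, ← LinearMap.trace_prodMap',
    ← LinearMap.trace_conj' _ (ρ.hIndTrEquiv hς m)]
  congr 1
  ext1 φ
  obtain ⟨φ, rfl⟩ := (ρ.hIndTrEquiv hς m).surjective φ
  rw [LinearEquiv.conj_apply_apply, LinearEquiv.symm_apply_apply]
  exact ρ.hIndTrEquiv_conj hς m hc e e' φ

lemma finite_tr_hInd [∀ g, Module.Finite k (𝟭 W ⟶ ρ.fn g)] {g : Γ} (hg : π g = 1) :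
    Module.Finite k ((ρ.hInd hς).Tr (g := g) hg) :=
  Module.Finite.equiv (ρ.hIndTrEquiv hς (g := ⟨g, hg⟩) (mul_inv_cancel _))

lemma betaOdd_hInd_app_fst {g ω g' : Γ} (hg : π g = 1) (hω : π ω = -1) (hg' : π g' = 1)
    (m : g' * ω = ω * g⁻¹) {φ : (ρ.hInd hς).Tr (g := g) hg} (h : ∀ X, (φ.app X).2 = 0)
    (X : W × Wᵒᵖ) : (((ρ.hInd hς).betaOdd hg hω hg' m φ).app X).1 = 0 := by
  have mate_snd (Y) : ((ρ.hInd hς).mate φ Y).2 = 0 :=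
    map_comp_eq_zero (ρ.fn (conjElt hς (sign_inv (ε := .even) hg))).op (h Y) _
  exact comp_map_comp_eq_zero (ρ.fn (mulElt hς hω)) (congrArg Quiver.Hom.unop (mate_snd _)) _ _

lemma betaOdd_hInd_app_snd {g ω g' : Γ} (hg : π g = 1) (hω : π ω = -1) (hg' : π g' = 1)
    (m : g' * ω = ω * g⁻¹) {φ : (ρ.hInd hς).Tr (g := g) hg} (h : ∀ X, (φ.app X).1 = 0)
    (X : W × Wᵒᵖ) : (((ρ.hInd hς).betaOdd hg hω hg' m φ).app X).2 = 0 := by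
  have mate_fst (Y) : ((ρ.hInd hς).mate φ Y).1 = 0 :=
    map_comp_eq_zero (ρ.fn (evenElt (sign_inv (ε := .even) hg))) (h Y) _
  exact comp_map_comp_eq_zero (ρ.fn (invMulElt hς hω)).op (congrArg Quiver.Hom.op (mate_fst _)) _ _

lemma char_hInd_of_odd {g ω : Γ} (hω : π ω = -1) : (ρ.hInd hς).char g ω = 0 := by
  rw [char, dif_neg (by rintro ⟨-, h, -⟩; rw [hω] at h; exact absurd h (by decide))]
  split_ifs with h
  swap; · rfl
  obtain ⟨hg, -, m⟩ := h
  let E := prodOpEquiv k (ρ.fn (evenElt hg)) (ρ.fn (conjElt hς hg))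
  let β := (ρ.hInd hς).betaOdd hg hω hg m
  refine (LinearMap.trace_conj' β E.symm).symm.trans
    (trace_eq_zero_of_diagonal_eq_zero _ (fun φ => ?_) fun θ => ?_)
  · ext x
    exact ρ.betaOdd_hInd_app_fst hς hg hω hg m (φ := E (φ, 0)) (fun _ => rfl) (x, op x)
  · ext y
    exact congrArg Quiver.Hom.unop
      (ρ.betaOdd_hInd_app_snd hς hg hω hg m (φ := E (0, θ)) (fun _ => rfl) (y, op y))

end TwistedRep

/-! ### Induction -/

lemma trace_pi_eq_sum {R ι : Type*} [CommRing R] [Fintype ι] [DecidableEq ι] {N : ι → Type*}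
    [∀ i, AddCommGroup (N i)] [∀ i, Module R (N i)] [∀ i, Module.Free R (N i)]
    [∀ i, Module.Finite R (N i)] (f : Module.End R (∀ i, N i)) :
    LinearMap.trace R _ f =
      ∑ i, LinearMap.trace R (N i) (LinearMap.proj i ∘ₗ f ∘ₗ LinearMap.single R N i) := by
  have h : f = ∑ i, (f ∘ₗ LinearMap.single R N i) ∘ₗ LinearMap.proj i := by
    refine LinearMap.ext fun x => ?_
    simp only [LinearMap.sum_apply, LinearMap.comp_apply, LinearMap.proj_apply,
      LinearMap.single_apply]
    rw [← map_sum, Finset.univ_sum_single]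
  conv_lhs => rw [h, map_sum]
  exact Finset.sum_congr rfl fun i _ => LinearMap.trace_comp_comm' _ _

section DeltaHom

variable {V : Type u} [Category.{v} V] [Preadditive V] {ι : Type*}

open Classical in
/-- The morphism `x i ⟶ x j` which is the identity if `i = j` and zero otherwise. -/
noncomputable def deltaHom (x : ι → V) (i j : ι) : x i ⟶ x j :=
  if h : i = j then eqToHom (congrArg x h) else 0

@[simp] lemma deltaHom_self (x : ι → V) (i : ι) : deltaHom x i i = 𝟙 (x i) := by
  simp [deltaHom]

lemma deltaHom_of_ne (x : ι → V) {i j : ι} (h : i ≠ j) : deltaHom x i j = 0 := by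
  simp [deltaHom, h]

lemma deltaHom_naturality {x y : ι → V} (f : x ⟶ y) (i j : ι) :
    f i ≫ deltaHom y i j = deltaHom x i j ≫ f j := by
  obtain rfl | h := eq_or_ne i j
  · rw [deltaHom_self, deltaHom_self, Category.comp_id, Category.id_comp]
  · rw [deltaHom_of_ne _ h, deltaHom_of_ne _ h, Limits.comp_zero, Limits.zero_comp]

end DeltaHom

namespace TwistedRep

variable {α : TwistedCocycle k π} {H : Subgroup Γ} {hH : H ≤ π.ker} {ι : Type*}
  {V : Type u} [Category.{v} V] [Preadditive V] [Linear k V]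
  (ρ : TwistedRep 1 (α.res hH) V) (R : CosetReps π H ι)

/-- The transformation `1 ⟹ Ind(ρ)(g)` assembled from a family of transformations
`1 ⟹ ρ(hⱼ)`, of which only those at the fixed points `j` of `g` contribute. -/
noncomputable def indTr (g : π.ker) :
    (∀ j, 𝟭 V ⟶ ρ.fn (R.coef g j)) →ₗ[k] (𝟭 (ι → V) ⟶ (ρ.ind R).fn g) where
  toFun θ :=
    { app := fun x j => (θ j).app (x j) ≫ (ρ.fn (R.coef g j)).map (deltaHom x j (R.idx g j))
      naturality := fun _ _ f => funext fun j =>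
        square_comp ((θ j).naturality (f j))
          (square_map _ (deltaHom_naturality f j (R.idx g j))) }
  map_add' _ _ := NatTrans.ext <| funext fun _ => funext fun _ => Preadditive.add_comp _ _ _ _ _ _
  map_smul' _ _ := NatTrans.ext <| funext fun _ => funext fun _ => Linear.smul_comp _ _ _ _ _ _

/-- The components at constant families of a transformation `1 ⟹ Ind(ρ)(g)`. -/
noncomputable def trInd (g : π.ker) :
    (𝟭 (ι → V) ⟶ (ρ.ind R).fn g) →ₗ[k] (∀ j, 𝟭 V ⟶ ρ.fn (R.coef g j)) where
  toFun Φ j :=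
    { app := fun v => Φ.app (fun _ => v) j
      naturality := fun v v' f =>
        congrFun (Φ.naturality (X := fun _ => v) (Y := fun _ => v') (fun _ => f)) j }
  map_add' _ _ := rfl
  map_smul' _ _ := rfl

variable {g : π.ker}

/-- Naturality along `deltaHom x j`, a morphism from the constant family at `x j` to `x`, shows that
a transformation `1 ⟹ Ind(ρ)(g)` is determined by its components at constant families. -/
lemma app_eq_trInd (Φ : 𝟭 (ι → V) ⟶ (ρ.ind R).fn g) (x : ι → V) (j : ι) :
    Φ.app x j = (ρ.trInd R g Φ j).app (x j) ≫
      (ρ.fn (R.coef g j)).map (deltaHom x j (R.idx g j)) := by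
  have h := congrFun (Φ.naturality (X := fun _ => x j) (Y := x) (deltaHom x j)) j
  exact ((congrArg (· ≫ Φ.app x j) (deltaHom_self x j)).trans (Category.id_comp _)).symm.trans h

lemma indTr_trInd (Φ : 𝟭 (ι → V) ⟶ (ρ.ind R).fn g) : ρ.indTr R g (ρ.trInd R g Φ) = Φ :=
  NatTrans.ext <| funext fun x => funext fun j => (ρ.app_eq_trInd R Φ x j).symm

lemma finite_tr_ind [Finite ι] [∀ h, Module.Finite k (𝟭 V ⟶ ρ.fn h)] (g : π.ker) :
    Module.Finite k (𝟭 (ι → V) ⟶ (ρ.ind R).fn g) :=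
  Module.Finite.of_surjective (ρ.indTr R g) fun Φ => ⟨_, ρ.indTr_trInd R Φ⟩

lemma trInd_apply_of_idx_ne {j : ι} (hj : R.idx g j ≠ j) (Φ : 𝟭 (ι → V) ⟶ (ρ.ind R).fn g) :
    ρ.trInd R g Φ j = 0 := by
  ext v
  refine (ρ.app_eq_trInd R Φ (fun _ => v) j).trans ?_
  rw [deltaHom_of_ne _ hj.symm, Functor.map_zero, Limits.comp_zero, NatTrans.app_zero]

lemma trInd_indTr_apply {j : ι} (hj : R.idx g j = j) (θ : ∀ i, 𝟭 V ⟶ ρ.fn (R.coef g i)) :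
    ρ.trInd R g (ρ.indTr R g θ) j = θ j := by
  ext v
  change (θ j).app v ≫ (ρ.fn (R.coef g j)).map (deltaHom (fun _ => v) j (R.idx g j)) = _
  rw [hj, deltaHom_self]
  exact (congrArg _ ((ρ.fn _).map_id _)).trans (Category.comp_id _)

lemma trInd_indTr_single_of_ne [DecidableEq ι] {i j : ι} (hij : i ≠ j)
    (θ : 𝟭 V ⟶ ρ.fn (R.coef g j)) : ρ.trInd R g (ρ.indTr R g (Pi.single j θ)) i = 0 := by
  obtain hi | hi := eq_or_ne (R.idx g i) i
  · rw [ρ.trInd_indTr_apply R hi, Pi.single_eq_of_ne hij]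
  · exact ρ.trInd_apply_of_idx_ne R hi _

lemma mulIsoIdx_const {h₂ h₁ h : H} (m : h₂ * h₁ = h) (v : V) {i j : ι} (e : i = j) :
    ρ.mulIsoIdx m (fun _ : ι => v) e = ρ.mulIso m v := by
  ext
  simp [mulIsoIdx]

lemma map_deltaHom_comp_mulIso {h n : H} (w : ι → H) {i j : ι} (e : i = j) (m : h * w i = n)
    (m' : h * w j = n) (v : V) :
    (ρ.fn h).map (deltaHom (fun i => (ρ.fn (w i)).obj v) j i) ≫ (ρ.mulIso m v).hom =
      (ρ.mulIso m' v).hom := by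
  subst e
  rw [deltaHom_self, CategoryTheory.Functor.map_id, Category.id_comp]

lemma map_app_comp_mulIso_congr {w n : H} (h : ι → H) (θ : ∀ i, 𝟭 V ⟶ ρ.fn (h i)) {i j : ι}
    (e : i = j) (m : w * h i = n) (m' : w * h j = n) (v : V) :
    (ρ.fn w).map ((θ i).app v) ≫ (ρ.mulIso m v).hom =
      (ρ.fn w).map ((θ j).app v) ≫ (ρ.mulIso m' v).hom := by
  subst e
  rfl

lemma trInd_conj_app {ω n : π.ker} (m : g * ω = n) (m' : ω * g = n) {j : ι} (hj : R.idx g j = j)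
    (mj : R.coef g j * R.coef ω j = R.coef n j) (Θ : 𝟭 (ι → V) ⟶ (ρ.ind R).fn g) (v : V) :
    (indCoeff α R g ω j : k) •
        ((ρ.trInd R g ((ρ.ind R).conj (m.trans m'.symm) Θ) j).app ((ρ.fn (R.coef ω j)).obj v) ≫
          (ρ.mulIso mj v).hom) =
      (indCoeff α R ω g j : k) •
        ((ρ.fn (R.coef ω j)).map ((ρ.trInd R g Θ (R.idx ω j)).app v) ≫
          (ρ.mulIso (R.coef_mul m' j) v).hom) := by
  have h := congrFun ((ρ.ind R).conj_app_fn_obj m m' Θ (fun _ => v)) j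
  rw [← ρ.map_deltaHom_comp_mulIso (R.coef ω) hj (R.coef_mul m j), ← Linear.comp_smul,
    ← Linear.comp_smul, ← ρ.mulIsoIdx_const (R.coef_mul m j) v (R.idx_mul m j),
    ← ρ.mulIsoIdx_const (R.coef_mul m' j) v (R.idx_mul m' j), ← Linear.comp_smul]
  refine Eq.trans ?_ h
  rw [← Category.assoc]
  exact congrArg (· ≫ _) (ρ.app_eq_trInd R ((ρ.ind R).conj (m.trans m'.symm) Θ)
    (fun i => (ρ.fn (R.coef ω i)).obj v) j).symm

/-- The diagonal block at `j` of conjugation by `ω` on `Hom(1, Ind(ρ)(g))`. -/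
noncomputable def indBlock [DecidableEq ι] {ω : π.ker} (e : g * ω = ω * g) (j : ι) :
    Module.End k (𝟭 V ⟶ ρ.fn (R.coef g j)) :=
  LinearMap.proj j ∘ₗ (ρ.trInd R g ∘ₗ (ρ.ind R).conj e ∘ₗ ρ.indTr R g) ∘ₗ
    LinearMap.single k (fun i => 𝟭 V ⟶ ρ.fn (R.coef g i)) j

lemma indBlock_eq_zero [DecidableEq ι] {ω : π.ker} (e : g * ω = ω * g) {j : ι}
    (hj : ¬(R.idx g j = j ∧ R.idx ω j = j)) : ρ.indBlock R e j = 0 := by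
  ext1 θ
  obtain hg | hg := ne_or_eq (R.idx g j) j
  · exact ρ.trInd_apply_of_idx_ne R hg _
  have hω : R.idx ω j ≠ j := fun h => hj ⟨hg, h⟩
  have mj : R.coef g j * R.coef ω j = R.coef (ω * g) j := by
    simpa only [hg] using R.coef_mul e j
  refine ρ.natTrans_ext_of_app_fn_obj (R.coef ω j) fun v => ?_
  have h := ρ.trInd_conj_app R e rfl hg mj (ρ.indTr R g (Pi.single j θ)) v
  rw [ρ.trInd_indTr_single_of_ne R hω, NatTrans.app_zero, Functor.map_zero, Limits.zero_comp,
    smul_zero, smul_eq_zero_iff_right (Units.ne_zero _)] at h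
  exact (cancel_mono (ρ.mulIso mj v).hom).1 (h.trans Limits.zero_comp.symm)

lemma indBlock_eq_smul_conj [DecidableEq ι] {ω : π.ker} (e : g * ω = ω * g) {j : ι}
    (hg : R.idx g j = j) (hω : R.idx ω j = j)
    (m : R.coef g j * R.coef ω j = R.coef ω j * R.coef g j) :
    ρ.indBlock R e j =
      (α.slant₂ (R.rep j) g (R.coef g j) ω (R.coef ω j) : k) • ρ.conj m := by
  have m' : R.coef ω j * R.coef g j = R.coef (ω * g) j := by
    simpa only [hω] using R.coef_mul (rfl : ω * g = _) j
  have hs : α.slant₂ (R.rep j) g (R.coef g j) ω (R.coef ω j) =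
      indCoeff α R ω g j / indCoeff α R g ω j := by
    simp only [indCoeff, hg, hω, TwistedCocycle.coeff_div_coeff_swap]
  ext1 θ
  have h : ρ.conj m θ = ((indCoeff α R ω g j / indCoeff α R g ω j : kˣ)⁻¹ : k) •
      ρ.indBlock R e j θ := by
    refine ρ.conj_eq_of_app_fn_obj (m.trans m') m' fun v => ?_
    have h' := ρ.trInd_conj_app R e rfl hg (m.trans m') (ρ.indTr R g (Pi.single j θ)) v
    rw [ρ.map_app_comp_mulIso_congr (R.coef g) _ hω _ m', ρ.trInd_indTr_apply R hg,
      Pi.single_eq_same] at h'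
    rw [NatTrans.app_smul, Linear.smul_comp, ← Units.val_inv_eq_inv_val, inv_div, div_eq_inv_mul,
      Units.val_mul, mul_smul]
    exact (congrArg _ h').trans (by rw [smul_smul, Units.inv_mul, one_smul])
  rw [LinearMap.smul_apply, h, hs, smul_smul, mul_inv_cancel₀ (Units.ne_zero _), one_smul]

open Classical in
lemma char_ind [Fintype ι] [∀ h, Module.Finite k (𝟭 V ⟶ ρ.fn h)] {ω : π.ker}
    (e : g * ω = ω * g) :
    (ρ.ind R).char g ω = ∑ j, if R.idx g j = j ∧ R.idx ω j = j then
      (α.slant₂ (R.rep j) g (R.coef g j) ω (R.coef ω j) : k) *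
        ρ.char (R.coef g j) (R.coef ω j)
      else 0 := by
  have := ρ.finite_tr_ind R g
  have h : (ρ.ind R).conj e = ((ρ.ind R).conj e ∘ₗ ρ.indTr R g) ∘ₗ ρ.trInd R g :=
    LinearMap.ext fun Φ => congrArg _ (ρ.indTr_trInd R Φ).symm
  rw [char_eq_trace_conj _ e, h, LinearMap.trace_comp_comm', trace_pi_eq_sum]
  refine Finset.sum_congr rfl fun j _ => ?_
  change LinearMap.trace k _ (ρ.indBlock R e j) = _
  split_ifs with hj
  · have m : R.coef g j * R.coef ω j = R.coef ω j * R.coef g j := by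
      have h₁ := R.coef_mul e j
      have h₂ := R.coef_mul (rfl : ω * g = _) j
      rw [hj.1] at h₁
      rw [hj.2] at h₂
      rw [h₁, h₂]
    rw [ρ.indBlock_eq_smul_conj R e hj.1 hj.2 m, map_smul, ρ.char_eq_trace_conj m, smul_eq_mul]
  · rw [ρ.indBlock_eq_zero R e hj, map_zero]

end TwistedRep

/-! ### The character formula -/

lemma realConj_mul_self (σ g : Γ) : realConj π σ g * σ = σ * g ^ ((π σ : ℤˣ) : ℤ) :=
  inv_mul_cancel_right _ _

lemma realConj_of_even {σ : Γ} (hσ : π σ = 1) (g : Γ) : realConj π σ g = σ * g * σ⁻¹ := by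
  simp [realConj, hσ]

lemma realConj_mul_of_even {x : Γ} (hx : π x = 1) (σ g : Γ) :
    realConj π (x * σ) g = realConj π x (realConj π σ g) := by
  simp [realConj, hx, mul_assoc]

lemma commute_realConj {σ g ω : Γ} (e : g * ω = ω * g) :
    realConj π σ g * (σ * ω * σ⁻¹) = σ * ω * σ⁻¹ * realConj π σ g :=
  commute_of_semiconjBy (realConj_mul_self σ g) (inv_mul_cancel_right _ _) (Commute.zpow_left e _)

namespace CosetReps

variable {H : Subgroup Γ} {ι : Type*} (R : CosetReps π H ι)

lemma idx_eq_self_iff {g : π.ker} {j : ι} :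
    R.idx g j = j ↔ (R.rep j : Γ)⁻¹ * g * R.rep j ∈ H :=
  ⟨fun h => by simpa only [coef, h] using (R.coef g j).2, R.idx_unique⟩

lemma coef_of_idx_eq_self {g : π.ker} {j : ι} (h : R.idx g j = j) :
    (R.coef g j : Γ) = (R.rep j : Γ)⁻¹ * g * R.rep j := by
  simp only [coef, h]

lemma eq_of_rep_inv_mul_mem {i j : ι} (h : (R.rep j : Γ)⁻¹ * R.rep i ∈ H) : i = j :=
  (R.existsUnique (R.rep i)).unique (by simp) h

include R in
lemma finite [Finite Γ] : Finite ι :=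
  Finite.of_injective R.rep fun i j h => R.eq_of_rep_inv_mul_mem (by simp [h])

lemma mul_inv_rep_inj {h h' : H} {i j : ι}
    (e : (h : Γ) * (R.rep i : Γ)⁻¹ = h' * (R.rep j : Γ)⁻¹) : h = h' ∧ i = j := by
  have hmem : (R.rep j : Γ)⁻¹ * R.rep i = (h' : Γ)⁻¹ * h := by
    rw [eq_inv_mul_iff_mul_eq, ← mul_assoc, ← e, inv_mul_cancel_right]
  obtain rfl := R.eq_of_rep_inv_mul_mem (hmem ▸ H.mul_mem (H.inv_mem h'.2) h.2)
  exact ⟨Subtype.ext (mul_right_cancel e), rfl⟩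

lemma exists_mul_inv_rep_eq {γ : Γ} (hγ : π γ = 1) :
    ∃ (h : H) (j : ι), (h : Γ) * (R.rep j : Γ)⁻¹ = γ := by
  obtain ⟨j, hj, -⟩ := R.existsUnique (⟨γ, hγ⟩ : π.ker)⁻¹
  exact ⟨⟨_, H.inv_mem hj⟩, j, by simp⟩

/-- The representatives `rⱼ⁻¹` and `rⱼ⁻¹ ς⁻¹` of the right cosets of `H` in `Γ`. -/
def repInv (ς : Γ) : ι ⊕ ι → Γ
  | .inl j => (R.rep j : Γ)⁻¹
  | .inr j => (R.rep j : Γ)⁻¹ * ς⁻¹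

lemma mul_repInv_bijective (hH : H ≤ π.ker) {ς : Γ} (hς : π ς = -1) :
    Function.Bijective fun p : H × (ι ⊕ ι) => (p.1 : Γ) * R.repInv ς p.2 := by
  have hrep : ∀ j, π (R.rep j : Γ) = 1 := fun j => (R.rep j).2
  have hπH : ∀ h : H, π (h : Γ) = 1 := fun h => hH h.2
  constructor
  · rintro ⟨h, i | i⟩ ⟨h', j | j⟩ e
    · obtain ⟨rfl, rfl⟩ := R.mul_inv_rep_inj e
      rfl
    · simpa [repInv, hrep, hπH, hς] using congrArg π e
    · simpa [repInv, hrep, hπH, hς] using congrArg π e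
    · simp only [repInv, ← mul_assoc] at e
      obtain ⟨rfl, rfl⟩ := R.mul_inv_rep_inj (mul_right_cancel e)
      rfl
  · intro γ
    obtain hγ | hγ := Int.units_eq_one_or (π γ)
    · obtain ⟨h, j, e⟩ := R.exists_mul_inv_rep_eq hγ
      exact ⟨(h, .inl j), e⟩
    · obtain ⟨h, j, e⟩ := R.exists_mul_inv_rep_eq (γ := γ * ς) (by simp [hγ, hς])
      exact ⟨(h, .inr j), by simp only [repInv, ← mul_assoc, e, mul_inv_cancel_right]⟩

end CosetReps

namespace TwistedRep

variable {α : TwistedCocycle k π} {H : Subgroup Γ} {hH : H ≤ π.ker} {ι : Type*}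
  {V : Type u} [Category.{v} V] [Preadditive V] [Linear k V] (ρ : TwistedRep 1 (α.res hH) V)

open Classical in
/-- The 2-character of a representation of `H`, extended by zero to `Γ`. -/
noncomputable def charExt (g ω : Γ) : k :=
  if h : g ∈ H ∧ ω ∈ H then ρ.char ⟨g, h.1⟩ ⟨ω, h.2⟩ else 0

lemma charExt_conj {g₁ g₀ ω₁ ω₀ : Γ} (h : H) (eg : g₁ * h = h * g₀) (eω : ω₁ * h = h * ω₀)
    (e : g₀ * ω₀ = ω₀ * g₀) :
    ρ.charExt g₁ ω₁ = (α.slant₂ h g₁ g₀ ω₁ ω₀ : k) * ρ.charExt g₀ ω₀ := by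
  have mem_iff : ∀ {x₁ x₀ : Γ}, x₁ * h = h * x₀ → (x₁ ∈ H ↔ x₀ ∈ H) := fun ex => by
    rw [← H.mul_mem_cancel_right h.2, ex, H.mul_mem_cancel_left h.2]
  by_cases hm : g₀ ∈ H ∧ ω₀ ∈ H
  · have hm' : g₁ ∈ H ∧ ω₁ ∈ H := ⟨(mem_iff eg).2 hm.1, (mem_iff eω).2 hm.2⟩
    rw [charExt, charExt, dif_pos hm, dif_pos hm']
    exact ρ.char_conj (g₀ := ⟨g₀, hm.1⟩) (ω₀ := ⟨ω₀, hm.2⟩) (g₁ := ⟨g₁, hm'.1⟩)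
      (ω₁ := ⟨ω₁, hm'.2⟩) (σ := h) (Subtype.ext e) (Subtype.ext eg) (Subtype.ext eω)
  · rw [charExt, charExt, dif_neg hm, dif_neg (by rwa [mem_iff eg, mem_iff eω]), mul_zero]

/-- The summand `ττ(α)([σ](g, ω))⁻¹ χ_ρ(σ g^π(σ) σ⁻¹, σ ω σ⁻¹)` of the character formula, read as
zero if the pair does not lie in `H`. -/
noncomputable def charTerm (g ω σ : Γ) : k :=
  (((α.transgress₂ σ g ω)⁻¹ : kˣ) : k) * ρ.charExt (realConj π σ g) (σ * ω * σ⁻¹)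

lemma charTerm_of_odd {ω : Γ} (hω : π ω = -1) (g σ : Γ) : ρ.charTerm g ω σ = 0 := by
  rw [charTerm, charExt, dif_neg, mul_zero]
  rintro ⟨-, hmem⟩
  have h : π (σ * ω * σ⁻¹) = 1 := hH hmem
  rw [map_mul, map_mul, map_inv, mul_inv_cancel_comm, hω] at h
  exact absurd h (by decide)

lemma charTerm_coe {g ω : Γ} (hω : π ω = 1) (e : g * ω = ω * g) (h : H) :
    ρ.charTerm g ω h = ρ.charExt g ω := by
  have hh : π (h : Γ) = 1 := hH h.2
  have eg : realConj π h g * h = h * g := by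
    rw [realConj_of_even hh, inv_mul_cancel_right]
  rw [charTerm, ρ.charExt_conj h eg (inv_mul_cancel_right _ _) e,
    α.transgress₂_of_even hh hω eg (inv_mul_cancel_right _ _) e, Units.inv_mul_cancel_left]

lemma charTerm_mul_of_even {g ω x : Γ} (hx : π x = 1) (hg : π g = 1) (hω : π ω = 1)
    (e : g * ω = ω * g) (σ : Γ) :
    ρ.charTerm g ω (x * σ) = (((α.transgress₂ σ g ω)⁻¹ : kˣ) : k) *
      ρ.charTerm (realConj π σ g) (σ * ω * σ⁻¹) x := by
  have eg : realConj π x (realConj π σ g) * x = x * realConj π σ g := by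
    rw [realConj_of_even hx, inv_mul_cancel_right]
  have eω : x * (σ * ω * σ⁻¹) * x⁻¹ * x = x * (σ * ω * σ⁻¹) := inv_mul_cancel_right _ _
  have hω' : x * σ * ω * (x * σ)⁻¹ = x * (σ * ω * σ⁻¹) * x⁻¹ := by
    simp only [mul_inv_rev, mul_assoc]
  rw [charTerm, charTerm, realConj_mul_of_even hx, hω', α.transgress₂_mul hx hg hω
    (realConj_mul_self σ g) (inv_mul_cancel_right _ _) eg eω e,
    α.transgress₂_of_even hx (by simp [hω]) eg eω (commute_realConj e), mul_inv_rev,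
    Units.val_mul, mul_assoc]

lemma charTerm_coe_mul {g ω : Γ} (hgω : GradedCommute π g ω) (h : H) (σ : Γ) :
    ρ.charTerm g ω (h * σ) = ρ.charTerm g ω σ := by
  obtain ⟨hg, e⟩ := hgω
  obtain hω | hω := Int.units_eq_one_or (π ω)
  · have e' : g * ω = ω * g := by simpa [hω] using e.symm
    rw [ρ.charTerm_mul_of_even (hH h.2) hg hω e',
      ρ.charTerm_coe (by simp [hω]) (commute_realConj e'), ← charTerm]
  · rw [ρ.charTerm_of_odd hω, ρ.charTerm_of_odd hω]

lemma char_ind_eq_sum_charTerm [Fintype ι] [∀ h, Module.Finite k (𝟭 V ⟶ ρ.fn h)]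
    (R : CosetReps π H ι) {g ω : π.ker} (e : g * ω = ω * g) :
    (ρ.ind R).char g ω = ∑ j, ρ.charTerm g ω (R.rep j : Γ)⁻¹ := by
  classical
  rw [ρ.char_ind R e]
  refine Finset.sum_congr rfl fun j _ => ?_
  have hr : π (R.rep j : Γ)⁻¹ = 1 := inv_mem (R.rep j).2
  rw [charTerm, realConj_of_even hr, inv_inv]
  by_cases hj : R.idx g j = j ∧ R.idx ω j = j
  · have hm := And.imp R.idx_eq_self_iff.1 R.idx_eq_self_iff.1 hj
    have hg := R.rep_mul_coef g j
    have hω := R.rep_mul_coef ω j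
    rw [hj.1] at hg
    rw [hj.2] at hω
    rw [if_pos hj, charExt, dif_pos hm, α.inv_transgress₂_inv_of_even (R.rep j).2
      (hH (R.coef g j).2) (hH (R.coef ω j).2) hg hω (congrArg Subtype.val e)]
    congr 2
    · exact Subtype.ext (R.coef_of_idx_eq_self hj.1)
    · exact Subtype.ext (R.coef_of_idx_eq_self hj.2)
  · rw [if_neg hj, charExt, dif_neg (by rwa [← R.idx_eq_self_iff, ← R.idx_eq_self_iff]), mul_zero]

lemma char_hInd_ind_of_even [Fintype ι] [∀ h, Module.Finite k (𝟭 V ⟶ ρ.fn h)]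
    (R : CosetReps π H ι) {ς : Γ} (hς : π ς = -1) {g ω : π.ker} (e : g * ω = ω * g) :
    ((ρ.ind R).hInd hς).char g ω = ∑ q, ρ.charTerm g ω (R.repInv ς q) := by
  have := ρ.finite_tr_ind R
  let b : π.ker := (conjElt hς g.2)⁻¹
  let c : π.ker := conjElt hς ω.2
  have m : conjElt hς g.2 * b = 1 := mul_inv_cancel _
  have hb : (b : Γ) = realConj π ς⁻¹ g := by simp [b, conjElt, realConj, hς, mul_assoc]
  have hc : (c : Γ) = ς⁻¹ * ω * ς⁻¹⁻¹ := by simp [c, conjElt]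
  have e' : (g : Γ) * ω = ω * g := congrArg Subtype.val e
  have ebc : b * c = c * b :=
    Subtype.ext (by simp only [Subgroup.coe_mul, hb, hc, commute_realConj e'])
  rw [(ρ.ind R).char_hInd_of_even hς m rfl e ebc,
    ← α.inv_transgress₂_inv_of_odd hς g.2 c.2 (by simp [conjElt, mul_assoc])
      (by simp [c, conjElt, mul_assoc]) (congrArg Subtype.val m) e',
    ρ.char_ind_eq_sum_charTerm R e, ρ.char_ind_eq_sum_charTerm R ebc, Fintype.sum_sum_type,
    Finset.mul_sum]
  congr 1
  refine Finset.sum_congr rfl fun j _ => ?_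
  rw [CosetReps.repInv, ρ.charTerm_mul_of_even (inv_mem (R.rep j).2) g.2 ω.2 e', hb, hc]

lemma char_hInd_ind [Fintype ι] [∀ h, Module.Finite k (𝟭 V ⟶ ρ.fn h)] (R : CosetReps π H ι)
    {ς : Γ} (hς : π ς = -1) {g ω : Γ} (hgω : GradedCommute π g ω) :
    ((ρ.ind R).hInd hς).char g ω = ∑ q, ρ.charTerm g ω (R.repInv ς q) := by
  obtain ⟨hg, e⟩ := hgω
  obtain hω | hω := Int.units_eq_one_or (π ω)
  · exact ρ.char_hInd_ind_of_even R hς (g := ⟨g, hg⟩) (ω := ⟨ω, hω⟩)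
      (Subtype.ext (by simpa [hω] using e.symm))
  · simp only [char_hInd_of_odd _ hς hω, ρ.charTerm_of_odd hω, Finset.sum_const_zero]

lemma sum_charTerm [Fintype Γ] [Fintype ι] (R : CosetReps π H ι) {ς : Γ} (hς : π ς = -1)
    {g ω : Γ} (hgω : GradedCommute π g ω) :
    ∑ σ, ρ.charTerm g ω σ = (Nat.card H : k) * ∑ q, ρ.charTerm g ω (R.repInv ς q) := by
  classical
  rw [← (R.mul_repInv_bijective hH hς).sum_comp, Fintype.sum_prod_type]
  simp only [ρ.charTerm_coe_mul hgω, Finset.sum_const, Finset.card_univ, nsmul_eq_mul,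
    Nat.card_eq_fintype_card]

lemma sum_subtype_eq_sum_charTerm [Fintype Γ] [DecidablePred (· ∈ H)] (g ω : Γ) :
    ∑ σ : {σ : Γ // realConj π σ g ∈ H ∧ σ * ω * σ⁻¹ ∈ H},
      (((α.transgress₂ σ g ω)⁻¹ : kˣ) : k) *
        ρ.char ⟨realConj π σ g, σ.2.1⟩ ⟨σ * ω * (σ : Γ)⁻¹, σ.2.2⟩ =
    ∑ σ, ρ.charTerm g ω σ := by
  refine Fintype.sum_of_injective _ Subtype.val_injective _ _ (fun σ hσ => ?_) fun σ => ?_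
  · rw [charTerm, charExt, dif_neg (fun h => hσ ⟨⟨σ, h⟩, rfl⟩), mul_zero]
  · rw [charTerm, charExt, dif_pos σ.2]

end TwistedRep

end RealTwoRep

theorem mainTheorem5_general {k : Type*} [Field k] {Γ : Type*} [Group Γ] (π : Γ →* ℤˣ)
    (α : RealTwoRep.TwistedCocycle k π) (H : Subgroup Γ) (hH : H ≤ π.ker)
    {V : Type u} [Category.{v} V] [Preadditive V] [Linear k V]
    (ρ : RealTwoRep.TwistedRep (1 : H →* ℤˣ) (α.res hH) V)
    (hfin : ∀ h : H, Module.Finite k (ρ.Tr (g := h) rfl))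
    {ι : Type w} [Fintype ι] (R : RealTwoRep.CosetReps π H ι) {ς : Γ} (hς : π ς = -1) :
    (∀ (g : Γ) (hg : π g = 1), Module.Finite k (((ρ.ind R).hInd hς).Tr (g := g) hg)) ∧
    (∀ g ω : Γ, RealTwoRep.GradedCommute π g ω →
      ((ρ.ind R).hInd hς).char g ω = ∑ q, ρ.charTerm g ω (R.repInv ς q)) ∧
    (∀ g ω : Γ, RealTwoRep.GradedCommute π g ω →
      ((ρ.ind R).hInd hς).char g ω ≠ 0 → ω ∈ π.ker) := by
  have : ∀ h, Module.Finite k (𝟭 V ⟶ ρ.fn h) := hfin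
  have := ρ.finite_tr_ind R
  refine ⟨fun _ hg => (ρ.ind R).finite_tr_hInd hς hg, fun _ _ => ρ.char_hInd_ind R hς,
    fun g ω _ hχ => ?_⟩
  exact (Int.units_eq_one_or (π ω)).resolve_right fun hω =>
    hχ ((ρ.ind R).char_hInd_of_odd hς hω)

theorem mainTheorem5 {k : Type*} [Field k] {Γ : Type*} [Group Γ] [Fintype Γ] (π : Γ →* ℤˣ)
    (α : RealTwoRep.TwistedCocycle k π) (H : Subgroup Γ) [DecidablePred (· ∈ H)]
    (hH : H ≤ π.ker) {V : Type u} [Category.{v} V] [Preadditive V] [Linear k V]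
    (ρ : RealTwoRep.TwistedRep (1 : H →* ℤˣ) (α.res hH) V)
    (hfin : ∀ h : H, Module.Finite k (ρ.Tr (g := h) rfl))
    {ι : Type w} (R : RealTwoRep.CosetReps π H ι) {ς : Γ} (hς : π ς = -1) :
    (∀ (g : Γ) (hg : π g = 1), Module.Finite k (((ρ.ind R).hInd hς).Tr (g := g) hg)) ∧
    ((Nat.card H : k) ≠ 0 → ∀ g ω : Γ, RealTwoRep.GradedCommute π g ω →
      ((ρ.ind R).hInd hς).char g ω =
        (1 / (Nat.card H : k)) *
          ∑ σ : {σ : Γ // RealTwoRep.realConj π σ g ∈ H ∧ σ * ω * σ⁻¹ ∈ H},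
            (((α.transgress₂ σ g ω)⁻¹ : kˣ) : k) *
              ρ.char ⟨RealTwoRep.realConj π σ g, σ.2.1⟩ ⟨σ * ω * (σ : Γ)⁻¹, σ.2.2⟩) ∧
    (∀ g ω : Γ, RealTwoRep.GradedCommute π g ω →
      ((ρ.ind R).hInd hς).char g ω ≠ 0 → ω ∈ π.ker) := by
  have := R.finite
  have := Fintype.ofFinite ι
  obtain ⟨finite_tr, char_eq, mem_ker⟩ := mainTheorem5_general π α H hH ρ hfin R hς
  refine ⟨finite_tr, fun hcard g ω hgω => ?_, mem_ker⟩
  rw [char_eq g ω hgω, ρ.sum_subtype_eq_sum_charTerm, ρ.sum_charTerm R hς hgω, one_div,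
    inv_mul_cancel_left₀ hcard]
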